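/- Let $d\ge 2$ and let $\mathbf X_i=(X_{i,1},\dots,X_{i,d})$, $i\ge 1$, be i.i.d. random vectors in $\mathbb R^d$ with law $\mathbb P$; write $\mathbf x_J=(x_3,\dots,x_d)$ for $\mathbf x\in\mathbb R^d$. Let $A_1,\dots,A_m\subset\mathbb R^{d-2}$ be Borel sets (not necessarily disjoint) with $p_k:=\mathbb P(\mathbf x_J\in A_k)>0$, let $\mathbb P_k$ be the conditional law of $\mathbf X_1$ given $\mathbf X_{1,J}\in A_k$, and assume that for every $k$ the first and the second marginal distribution functions of $\mathbb P_k$ are continuous. The conditional Kendall's tau is $$\tau_k=\Pr\big((X_{1,1}-X_{2,1})(X_{1,2}-X_{2,2})>0\mid \mathbf X_{1,J},\mathbf X_{2,J}\in A_k\big)-\Pr\big((X_{1,1}-X_{2,1})(X_{1,2}-X_{2,2})<0\mid \mathbf X_{1,J},\mathbf X_{2,J}\in A_k\big).$$ For $n\ge1$ put $N_k=\sum_{i=1}^n\mathbf 1\{\mathbf X_{i,J}\in A_k\}$, $w^{(k)}_i=\mathbf 1\{\mathbf X_{i,J}\in A_k\}/N_k$, $s^{(k)}=\sum_{i=1}^n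 (w^{(k)}_i)^2$, and $$\hat\tau^{(1)}_k=4\sum_{i,j=1}^n w^{(k)}_iw^{(k)}_j\mathbf 1\{X_{i,1}<X_{j,1},X_{i,2}<X_{j,2}\}-1,$$ $$\hat\tau^{(2)}_k=\sum_{i,j=1}^n w^{(k)}_iw^{(k)}_j\big(\mathbf 1\{(X_{i,1}-X_{j,1})(X_{i,2}-X_{j,2})>0\}-\mathbf 1\{(X_{i,1}-X_{j,1})(X_{i,2}-X_{j,2})<0\}\big),$$ $$\hat\tau^{(3)}_k=1-4\sum_{i,j=1}^n w^{(k)}_iw^{(k)}_j\mathbf 1\{X_{i,1}<X_{j,1},X_{i,2}>X_{j,2}\},\qquad \hat\tau_k=\frac{\hat\tau_k^{(1)}+s^{(k)}}{1-s^{(k)}},$$ where quotients with zero denominator (which occur with probability tending to $0$) are set to $0$. Put $$\pi(\mathbf x,\mathbf y)=\tfrac12\big(\mathbf 1\{x_1<y_1,x_2<y_2\}+\mathbf 1\{y_1<x_1,y_2<x_2\}\big),\qquad p_{k,l}=\mathbb P(\mathbf x_J\in A_k\cap A_l),$$ $$D_k=\Pr(X_{1,1}<X_{2,1},\,X_{1,2}<X_{2,2},\,\mathbf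 X_{1,J}\in A_k,\,\mathbf X_{2,J}\in A_k),$$ $$I_{k,l}=\int \mathbf 1\{\mathbf x_{3,J}\in A_k\cap A_l\}\,\pi(\mathbf x_1,\mathbf x_3)\,\pi(\mathbf x_2,\mathbf x_3)\,\mathbb P_k(d\mathbf x_1)\,\mathbb P_l(d\mathbf x_2)\,\mathbb P(d\mathbf x_3),$$ $$J_{k,l}=\int \mathbf 1\{\mathbf x_{2,J}\in A_k\cap A_l\}\,\pi(\mathbf x_1,\mathbf x_2)\,\mathbb P_k(d\mathbf x_1)\,\mathbb P(d\mathbf x_2).$$ Then the matrix $$\Delta=64\Big[\frac{I_{k,l}}{p_kp_l}+\frac{D_kD_l\,p_{k,l}}{p_k^3p_l^3}-\frac{D_l\,J_{k,l}}{p_kp_l^3}-\frac{D_k\,J_{l,k}}{p_lp_k^3}\Big]_{1\le k,l\le m}$$ is positive semidefinite and, as $n\to\infty$, the random vector $\big(\sqrt n(\hat\tau_k-\tau_k)\big)_{1\le k\le m}$, as well as each of the vectors $\big(\sqrt n(\hat\tau^{(j)}_k-\tau_k)\big)_{1\le k\le m}$, $j\in\{1,2,3\}$, converges in law to $\mathcal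 N(0,\Delta)$. If moreover the sets $A_1,\dots,A_m$ are pairwise disjoint, then $$\Delta=16\,\mathrm{Diag}\Big(\frac{4I_{k,k}}{p_k^2}-\frac{(1+\tau_k)^2}{4p_k}\Big)_{1\le k\le m}.$$ -/

import Mathlib

open MeasureTheory ProbabilityTheory Filter

namespace CondKendall

noncomputable section

/-- Indicator `𝟏{p}` of a proposition, as a real number. -/
def ind (p : Prop) : ℝ := by
  classical exact if p then 1 else 0

/-- The conditioning part `x_J = (x₃, …, x_d)` of a vector `x = (x₁, x₂, x₃, …, x_d)` of `ℝ^d`,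
where `d = q + 2`. The two conditioned coordinates are `x 0` and `x 1`. -/
def coordJ {q : ℕ} (x : Fin (q + 2) → ℝ) : Fin q → ℝ := fun j => x j.succ.succ

/-! ### Estimators, as functions of a sample `x 0, …, x (n - 1)` -/

/-- Size of the subsample of the indices `i < n` with `x_{i,J} ∈ A`. -/
def subsampleSize {q : ℕ} (A : Set (Fin q → ℝ)) (n : ℕ) (x : ℕ → Fin (q + 2) → ℝ) : ℝ :=
  ∑ i ∈ Finset.range n, ind (coordJ (x i) ∈ A)

/-- The weight `w_{i,n} = 𝟏{x_{i,J} ∈ A} / N_n`. -/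
def weight {q : ℕ} (A : Set (Fin q → ℝ)) (n : ℕ) (x : ℕ → Fin (q + 2) → ℝ) (i : ℕ) : ℝ :=
  ind (coordJ (x i) ∈ A) / subsampleSize A n x

/-- `s_n = ∑ᵢ w_{i,n}²`. -/
def sumSqWeight {q : ℕ} (A : Set (Fin q → ℝ)) (n : ℕ) (x : ℕ → Fin (q + 2) → ℝ) : ℝ :=
  ∑ i ∈ Finset.range n, weight A n x i ^ 2

/-- The estimator `τ̂⁽¹⁾`. -/
def tauHat1 {q : ℕ} (A : Set (Fin q → ℝ)) (n : ℕ) (x : ℕ → Fin (q + 2) → ℝ) : ℝ :=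
  4 * (∑ i ∈ Finset.range n, ∑ j ∈ Finset.range n,
    weight A n x i * weight A n x j * ind (x i 0 < x j 0 ∧ x i 1 < x j 1)) - 1

/-- The estimator `τ̂⁽²⁾`. -/
def tauHat2 {q : ℕ} (A : Set (Fin q → ℝ)) (n : ℕ) (x : ℕ → Fin (q + 2) → ℝ) : ℝ :=
  ∑ i ∈ Finset.range n, ∑ j ∈ Finset.range n,
    weight A n x i * weight A n x j *
      (ind (0 < (x i 0 - x j 0) * (x i 1 - x j 1)) - ind ((x i 0 - x j 0) * (x i 1 - x j 1) < 0))

/-- The estimator `τ̂⁽³⁾`. -/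
def tauHat3 {q : ℕ} (A : Set (Fin q → ℝ)) (n : ℕ) (x : ℕ → Fin (q + 2) → ℝ) : ℝ :=
  1 - 4 * (∑ i ∈ Finset.range n, ∑ j ∈ Finset.range n,
    weight A n x i * weight A n x j * ind (x i 0 < x j 0 ∧ x j 1 < x i 1))

/-- The rescaled estimator `τ̂`. -/
def tauHat {q : ℕ} (A : Set (Fin q → ℝ)) (n : ℕ) (x : ℕ → Fin (q + 2) → ℝ) : ℝ :=
  tauHat1 A n x / (1 - sumSqWeight A n x) + sumSqWeight A n x / (1 - sumSqWeight A n x)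

/-- For estimators `T` and centerings `c`, the vector `(√n (T(A_k) - c_k))_k`. -/
def scaledVector {q m : ℕ}
    (T : Set (Fin q → ℝ) → ℕ → (ℕ → Fin (q + 2) → ℝ) → ℝ)
    (A : Fin m → Set (Fin q → ℝ)) (c : Fin m → ℝ) (n : ℕ) (x : ℕ → Fin (q + 2) → ℝ) :
    EuclideanSpace ℝ (Fin m) :=
  WithLp.toLp 2 fun k => √(n : ℝ) * (T (A k) n x - c k)

/-! ### Population quantities, for a law `P` on `ℝ^d` -/

/-- The law of `X` given `X_J ∈ A`. -/
def condLaw {q : ℕ} (P : Measure (Fin (q + 2) → ℝ)) (A : Set (Fin q → ℝ)) :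
    Measure (Fin (q + 2) → ℝ) :=
  P[|{x | coordJ x ∈ A}]

/-- Conditional Kendall's tau of the first two coordinates given `X_J ∈ A`: probability of
concordance minus probability of discordance of two independent copies `X₁, X₂` of `X`, given
that `X_{1,J} ∈ A` and `X_{2,J} ∈ A`. -/
def tau {q : ℕ} (P : Measure (Fin (q + 2) → ℝ)) (A : Set (Fin q → ℝ)) : ℝ :=
  ((P.prod P)[|{z | coordJ z.1 ∈ A ∧ coordJ z.2 ∈ A}]).real
      {z | 0 < (z.1 0 - z.2 0) * (z.1 1 - z.2 1)}
    - ((P.prod P)[|{z | coordJ z.1 ∈ A ∧ coordJ z.2 ∈ A}]).real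
      {z | (z.1 0 - z.2 0) * (z.1 1 - z.2 1) < 0}

/-- `ℙ(X_J ∈ A)`. Both `p_k` and `p_{k,l}` (with `A = A_k ∩ A_l`) are of this form. -/
def prob {q : ℕ} (P : Measure (Fin (q + 2) → ℝ)) (A : Set (Fin q → ℝ)) : ℝ :=
  P.real {x | coordJ x ∈ A}

/-- `D_k`. -/
def concD {q : ℕ} (P : Measure (Fin (q + 2) → ℝ)) (A : Set (Fin q → ℝ)) : ℝ :=
  (P.prod P).real
    {z | z.1 0 < z.2 0 ∧ z.1 1 < z.2 1 ∧ coordJ z.1 ∈ A ∧ coordJ z.2 ∈ A}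

/-- The symmetrized concordance kernel `π(x, y)`. -/
def concKernel {q : ℕ} (x y : Fin (q + 2) → ℝ) : ℝ :=
  (ind (x 0 < y 0 ∧ x 1 < y 1) + ind (y 0 < x 0 ∧ y 1 < x 1)) / 2

/-- `I_{k,l}`, with `A = A_k` and `B = A_l`. -/
def coefI {q : ℕ} (P : Measure (Fin (q + 2) → ℝ)) (A B : Set (Fin q → ℝ)) : ℝ :=
  ∫ x₃, ∫ x₂, ∫ x₁, ind (coordJ x₃ ∈ A ∩ B) * concKernel x₁ x₃ * concKernel x₂ x₃
    ∂(condLaw P A) ∂(condLaw P B) ∂P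

/-- `J_{k,l}`, with `A = A_k` and `B = A_l`. -/
def coefJ {q : ℕ} (P : Measure (Fin (q + 2) → ℝ)) (A B : Set (Fin q → ℝ)) : ℝ :=
  ∫ x₂, ∫ x₁, ind (coordJ x₂ ∈ A ∩ B) * concKernel x₁ x₂ ∂(condLaw P A) ∂P

/-- The matrix `Δ`. -/
def limitCov {q m : ℕ} (P : Measure (Fin (q + 2) → ℝ)) (A : Fin m → Set (Fin q → ℝ)) :
    Matrix (Fin m) (Fin m) ℝ :=
  Matrix.of fun k l => 64 *
    (coefI P (A k) (A l) / (prob P (A k) * prob P (A l))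
      + concD P (A k) * concD P (A l) * prob P (A k ∩ A l) / (prob P (A k) ^ 3 * prob P (A l) ^ 3)
      - concD P (A l) * coefJ P (A k) (A l) / (prob P (A k) * prob P (A l) ^ 3)
      - concD P (A k) * coefJ P (A l) (A k) / (prob P (A l) * prob P (A k) ^ 3))

end

end CondKendall

/-! Each estimator is, up to a negligible term, a smooth function of two averages, so the result is
a delta method for a V-statistic. For one set `A`, let V be `pairSum` and N the subsample size.
Symmetrizing gives τ̂⁽¹⁾ = 4V/N² - 1. Continuity of the conditional marginals excludes ties, so
discordance is the complement of concordance off the diagonal. Hence τ = 4D/p² - 1 (`tau_eq`), and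
the other three estimators differ from τ̂⁽¹⁾ by at most 8/N (`abs_sub_tauHat1_le`).

The Hoeffding decomposition (`pairSum_eq`) reads V = n²D + 2nL + R, with L a sum of centered i.i.d.
terms and R a degenerate V-statistic; similarly N = np + B. Expanding v/u² around (D, p) makes √n(τ̂
- τ) equal to n^(-1/2) times the sum of `influence` over the sample, plus a remainder. That
remainder is at most a constant times √n (R²/n³ + L²/n² + B²/n² + 1/n) on the event |B| ≤ np/2
(`exists_abs_expansion_le`). Degeneracy gives E R² = O(n²) (`integral_sq_sum_kernel_le`), so the
bracket has mean O(1/n) and Markov's inequality finishes (`tendsto_measure_expansion`).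

By `limitCov_eq`, Δ is the matrix of second moments of the influence functions. This gives positive
semidefiniteness and identifies the limit in the multivariate central limit theorem; Slutsky's lemma
transfers that limit to the estimators. For disjoint sets the influence functions have disjoint
supports, so Δ is diagonal. -/

namespace CondKendall

/-! ### Second-moment matrices and the multivariate central limit theorem. -/

section Generic

open scoped Topology

variable {Ω E : Type*} [MeasurableSpace Ω] [MeasurableSpace E]

/-- The quadratic form of a matrix of second moments. -/
theorem dotProduct_mulVec_integral_mul (P : Measure E) {m : ℕ} (φ : Fin m → E → ℝ)
    (hφ : ∀ k, MemLp (φ k) 2 P) (t : Fin m → ℝ) :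
    t ⬝ᵥ (Matrix.of fun k l => ∫ x, φ k x * φ l x ∂P).mulVec t
      = ∫ x, (∑ k, t k * φ k x) ^ 2 ∂P := by
  have hint : ∀ k l, Integrable (fun x => t k * φ k x * (t l * φ l x)) P := fun k l =>
    (((hφ k).integrable_mul (hφ l)).const_mul (t k * t l)).congr
      (ae_of_all _ fun x => by simp only [Pi.mul_apply]; ring)
  simp only [sq, Finset.sum_mul_sum]
  rw [integral_finsetSum _ fun k _ => integrable_finsetSum _ fun l _ => hint k l]
  simp only [dotProduct, Matrix.mulVec, Matrix.of_apply, Finset.mul_sum]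
  refine Finset.sum_congr rfl fun k _ => ?_
  rw [integral_finsetSum _ fun l _ => hint k l]
  refine Finset.sum_congr rfl fun l _ => ?_
  rw [← integral_mul_const, ← integral_const_mul]
  congr 1; ext x; ring

/-- A matrix of second moments is positive semidefinite. -/
theorem posSemidef_integral_mul (P : Measure E) {m : ℕ} (φ : Fin m → E → ℝ)
    (hφ : ∀ k, MemLp (φ k) 2 P) :
    (Matrix.of fun k l => ∫ x, φ k x * φ l x ∂P).PosSemidef := by
  refine Matrix.PosSemidef.of_dotProduct_mulVec_nonneg ?_ fun t => ?_
  · ext k l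
    simp [mul_comm]
  · rw [star_trivial, dotProduct_mulVec_integral_mul P φ hφ]
    exact integral_nonneg fun x => sq_nonneg _

/-- The multivariate central limit theorem for centered functions of an i.i.d. sequence. -/
theorem tendstoInDistribution_inv_sqrt_mul_sum_vector {μ : Measure Ω} [IsProbabilityMeasure μ]
    {P : Measure E} {X : ℕ → Ω → E} (hindep : iIndepFun X μ) (hlaw : ∀ i, HasLaw (X i) P μ)
    {m : ℕ} (φ : Fin m → E → ℝ) (hmeas : ∀ k, Measurable (φ k)) (hφ : ∀ k, MemLp (φ k) 2 P)
    (h0 : ∀ k, ∫ x, φ k x ∂P = 0) :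
    TendstoInDistribution
      (fun (n : ℕ) ω => (WithLp.toLp 2 fun k => (√(n : ℝ))⁻¹ *
        ∑ i ∈ Finset.range n, φ k (X i ω) : EuclideanSpace ℝ (Fin m)))
      atTop (id : EuclideanSpace ℝ (Fin m) → EuclideanSpace ℝ (Fin m)) (fun _ => μ)
      (multivariateGaussian 0 (Matrix.of fun k l => ∫ x, φ k x * φ l x ∂P)) := by
  have hP : IsProbabilityMeasure P := (hlaw 0).isProbabilityMeasure_iff.1 inferInstance
  have hX : ∀ i, AEMeasurable (X i) μ := fun i => (hlaw i).aemeasurable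
  have hS := posSemidef_integral_mul P φ hφ
  have hae : ∀ n : ℕ, AEMeasurable (fun ω => (WithLp.toLp 2 fun k => (√(n : ℝ))⁻¹ *
      ∑ i ∈ Finset.range n, φ k (X i ω) : EuclideanSpace ℝ (Fin m))) μ := by
    intro n
    refine (WithLp.measurable_toLp 2 _).comp_aemeasurable (aemeasurable_pi_lambda _ fun k => ?_)
    exact (Finset.aemeasurable_fun_sum _ fun i _ => (hmeas k).comp_aemeasurable (hX i)).const_mul _
  refine ⟨hae, aemeasurable_id, ?_⟩
  refine ProbabilityMeasure.tendsto_iff_tendsto_charFun.2 fun t => ?_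
  -- Cramér–Wold: the characteristic function of the vector at t is that of the normalized scalar
  -- sum of ψ at 1, so the one-dimensional central limit theorem applies.
  obtain ⟨ψ, hψ⟩ : ∃ ψ : E → ℝ, ψ = fun x => ∑ k, t k * φ k x := ⟨_, rfl⟩
  have hψm : Measurable ψ := hψ ▸ Finset.measurable_sum _ fun k _ => (hmeas k).const_mul _
  have hψ2 : MemLp ψ 2 P := hψ ▸ memLp_finsetSum _ fun k _ => (hφ k).const_mul _
  have hψ0 : ∫ x, ψ x ∂P = 0 := by
    rw [hψ, integral_finsetSum _ fun k _ => ((hφ k).integrable one_le_two).const_mul _]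
    simp [integral_const_mul, h0]
  have hE0 : μ[fun ω => ψ (X 0 ω)] = 0 := by
    rw [← hψ0]; exact (hlaw 0).integral_comp hψm.aestronglyMeasurable
  have hvar : Var[fun ω => ψ (X 0 ω); μ] =
      t ⬝ᵥ (Matrix.of fun k l => ∫ x, φ k x * φ l x ∂P).mulVec t := by
    rw [variance_of_integral_eq_zero (X := fun ω => ψ (X 0 ω)) (hψm.comp_aemeasurable (hX 0)) hE0]
    rw [show ∫ ω, ψ (X 0 ω) ^ 2 ∂μ = ∫ x, ψ x ^ 2 ∂P from
      (hlaw 0).integral_comp (f := fun x => ψ x ^ 2) (hψm.pow_const 2).aestronglyMeasurable]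
    rw [dotProduct_mulVec_integral_mul P φ hφ, hψ]
  have hclt := tendstoInDistribution_inv_sqrt_mul_sum_sub (P := μ)
    (X := fun i ω => ψ (X i ω)) (Y := id)
    (P' := gaussianReal 0 (Var[fun ω => ψ (X 0 ω); μ]).toNNReal) HasLaw.id
    (MemLp.comp_of_map (by rwa [(hlaw 0).map_eq]) (hX 0))
    (hindep.comp (fun _ => ψ) fun _ => hψm)
    (fun i => (IdentDistrib.comp ⟨hX i, hX 0, by rw [(hlaw i).map_eq, (hlaw 0).map_eq]⟩ hψm))
  have hconv := ProbabilityMeasure.tendsto_iff_tendsto_charFun.1 hclt.tendsto 1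
  simp only [hE0, mul_zero, sub_zero, ProbabilityMeasure.coe_mk, Measure.map_id,
    charFun_gaussianReal] at hconv
  simp only [ProbabilityMeasure.coe_mk, Measure.map_id, charFun_multivariateGaussian hS]
  convert! hconv using 1
  · ext n
    rw [charFun_apply, charFun_apply, integral_map (hae n) (by fun_prop), integral_map]
    · congr 1; ext ω
      congr 2
      simp only [PiLp.inner_apply, hψ, RCLike.inner_apply, conj_trivial, one_mul]
      rw [Finset.sum_comm]
      simp only [Finset.mul_sum]
      norm_cast
      refine Finset.sum_congr rfl fun k _ => Finset.sum_congr rfl fun l _ => ?_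
      ring
    · exact (Finset.aemeasurable_fun_sum _ fun i _ => hψm.comp_aemeasurable (hX i)).const_mul _
    · fun_prop
  · congr 2
    rw [Real.coe_toNNReal _ (variance_nonneg _ _), hvar]
    simp

end Generic

/-! ### Second-moment bounds for i.i.d. sums and degenerate V-statistics. -/

section SecondMoments

variable {Ω E : Type*} [MeasurableSpace Ω] [MeasurableSpace E] {μ : Measure Ω}
  [IsProbabilityMeasure μ] {P : Measure E} {X : ℕ → Ω → E}

/-- The second moment of a sum of bounded centered functions of an i.i.d. sequence. -/
theorem integral_sq_sum_comp_le (hindep : iIndepFun X μ) (hlaw : ∀ i, HasLaw (X i) P μ)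
    {f : E → ℝ} (hf : Measurable f) {C : ℝ} (hC : ∀ x, |f x| ≤ C) (h0 : ∫ x, f x ∂P = 0) (n : ℕ) :
    ∫ ω, (∑ i ∈ Finset.range n, f (X i ω)) ^ 2 ∂μ ≤ n * C ^ 2 := by
  have hX : ∀ i, AEMeasurable (fun ω => f (X i ω)) μ := fun i =>
    hf.comp_aemeasurable (hlaw i).aemeasurable
  have hL : ∀ i, MemLp (fun ω => f (X i ω)) 2 μ := fun i =>
    MemLp.of_bound (hX i).aestronglyMeasurable C (ae_of_all _ fun ω => hC _)
  have hE : ∀ i, ∫ ω, f (X i ω) ∂μ = 0 := fun i => by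
    rw [← h0]; exact (hlaw i).integral_comp hf.aestronglyMeasurable
  have hsum : ∫ ω, ∑ i ∈ Finset.range n, f (X i ω) ∂μ = 0 := by
    rw [integral_finsetSum _ fun i _ => (hL i).integrable one_le_two]
    simp [hE]
  have hvar : Var[fun ω => ∑ i ∈ Finset.range n, f (X i ω); μ]
      = ∫ ω, (∑ i ∈ Finset.range n, f (X i ω)) ^ 2 ∂μ :=
    variance_of_integral_eq_zero (Finset.aemeasurable_fun_sum _ fun i _ => hX i) hsum
  have hind := hindep.comp (fun _ => f) fun _ => hf
  have hvs := IndepFun.variance_sum (μ := μ) (X := fun i ω => f (X i ω)) (s := Finset.range n)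
    (fun i _ => hL i) (fun i _ j _ hij => hind.indepFun hij)
  rw [← hvar]
  have heq : (∑ i ∈ Finset.range n, fun ω => f (X i ω)) =
      fun ω => ∑ i ∈ Finset.range n, f (X i ω) := by ext ω; simp
  rw [heq] at hvs
  rw [hvs]
  calc ∑ i ∈ Finset.range n, Var[fun ω => f (X i ω); μ] ≤ ∑ i ∈ Finset.range n, C ^ 2 := by
        refine Finset.sum_le_sum fun i _ => ?_
        rw [variance_of_integral_eq_zero (X := fun ω => f (X i ω)) (hX i) (hE i)]
        refine (integral_mono (hL i).integrable_sq (integrable_const (C ^ 2)) fun ω => ?_).trans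
          (by simp)
        exact sq_le_sq' (neg_le_of_abs_le (hC _)) (le_of_abs_le (hC _))
    _ = n * C ^ 2 := by simp

/-- Products of values of a degenerate kernel have mean zero if the first index is isolated. -/
theorem integral_kernel_mul_kernel_eq_zero (hindep : iIndepFun X μ)
    (hlaw : ∀ i, HasLaw (X i) P μ) {h : E → E → ℝ} (hh : Measurable (Function.uncurry h)) {C : ℝ}
    (hC : ∀ x y, |h x y| ≤ C) (h0 : ∀ y, ∫ x, h x y ∂P = 0) {i j k l : ℕ}
    (hij : i ≠ j) (hik : i ≠ k) (hil : i ≠ l) :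
    ∫ ω, h (X i ω) (X j ω) * h (X k ω) (X l ω) ∂μ = 0 := by
  have hP : IsProbabilityMeasure P := (hlaw 0).isProbabilityMeasure_iff.1 inferInstance
  have hX : ∀ i, AEMeasurable (X i) μ := fun i => (hlaw i).aemeasurable
  have hW : AEMeasurable (fun ω => (X j ω, X k ω, X l ω)) μ :=
    (hX j).prodMk ((hX k).prodMk (hX l))
  have hI : IndepFun (X i) (fun ω => (X j ω, X k ω, X l ω)) μ := by
    -- The indices j, k, l may coincide: the block is a `Finset`, and its coordinates are read off
    -- with repetitions.
    have h1 := hindep.indepFun_finset₀ {i} {j, k, l} (by simp [hij, hik, hil]) hX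
    have m1 : Measurable fun v : ({i} : Finset ℕ) → E => v ⟨i, by simp⟩ := measurable_pi_apply _
    have m2 : Measurable fun v : ({j, k, l} : Finset ℕ) → E =>
        (v ⟨j, by simp⟩, v ⟨k, by simp⟩, v ⟨l, by simp⟩) :=
      (measurable_pi_apply _).prodMk ((measurable_pi_apply _).prodMk (measurable_pi_apply _))
    exact h1.comp m1 m2
  have hmap := (indepFun_iff_map_prod_eq_prod_map_map (hX i) hW).1 hI
  rw [(hlaw i).map_eq] at hmap
  have hFm : Measurable (fun z : E × E × E × E => h z.1 z.2.1 * h z.2.2.1 z.2.2.2) :=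
    (hh.comp (f := fun z : E × E × E × E => (z.1, z.2.1)) (by fun_prop)).mul
      (hh.comp (f := fun z : E × E × E × E => (z.2.2.1, z.2.2.2)) (by fun_prop))
  have : IsProbabilityMeasure (μ.map fun ω => (X j ω, X k ω, X l ω)) :=
    Measure.isProbabilityMeasure_map hW
  have hint : Integrable (fun z : E × E × E × E => h z.1 z.2.1 * h z.2.2.1 z.2.2.2)
      (P.prod (μ.map fun ω => (X j ω, X k ω, X l ω))) := by
    refine Integrable.of_bound hFm.aestronglyMeasurable (C * C) (ae_of_all _ fun z => ?_)
    rw [Real.norm_eq_abs, abs_mul]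
    exact mul_le_mul (hC _ _) (hC _ _) (abs_nonneg _) ((abs_nonneg _).trans (hC z.1 z.1))
  have h1 := integral_map (μ := μ) ((hX i).prodMk hW)
    (f := fun z : E × E × E × E => h z.1 z.2.1 * h z.2.2.1 z.2.2.2) hFm.aestronglyMeasurable
  rw [← h1, hmap, integral_prod_symm _ hint]
  simp [integral_mul_const, h0]

/-- The second moment of a degenerate V-statistic with bounded kernel grows at most like `n²`. -/
theorem integral_sq_sum_kernel_le (hindep : iIndepFun X μ)
    (hlaw : ∀ i, HasLaw (X i) P μ) {h : E → E → ℝ} (hh : Measurable (Function.uncurry h)) {C : ℝ}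
    (hC : ∀ x y, |h x y| ≤ C) (hsymm : ∀ x y, h x y = h y x) (h0 : ∀ y, ∫ x, h x y ∂P = 0)
    (n : ℕ) :
    ∫ ω, (∑ i ∈ Finset.range n, ∑ j ∈ Finset.range n, h (X i ω) (X j ω)) ^ 2 ∂μ
      ≤ 3 * C ^ 2 * n ^ 2 := by
  have hX : ∀ i, AEMeasurable (X i) μ := fun i => (hlaw i).aemeasurable
  have hb : ∀ i j k l ω, |h (X i ω) (X j ω) * h (X k ω) (X l ω)| ≤ C ^ 2 := fun i j k l ω => by
    rw [abs_mul, sq]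
    exact mul_le_mul (hC _ _) (hC _ _) (abs_nonneg _) ((abs_nonneg _).trans (hC (X i ω) (X i ω)))
  have hint : ∀ i j k l, Integrable (fun ω => h (X i ω) (X j ω) * h (X k ω) (X l ω)) μ :=
    fun i j k l => Integrable.of_bound
      ((hh.comp_aemeasurable ((hX i).prodMk (hX j))).mul
        (hh.comp_aemeasurable ((hX k).prodMk (hX l)))).aestronglyMeasurable (C ^ 2)
      (ae_of_all _ fun ω => hb i j k l ω)
  let δ : ℕ → ℕ → ℝ := fun i j => if i = j then 1 else 0
  have hδ : ∀ i j, 0 ≤ δ i j := fun i j => by simp only [δ]; split_ifs <;> simp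
  -- If the four indices do not match up in one of the three pairings, one of them differs from the
  -- other three and the expectation vanishes. Each pairing leaves two free indices, hence n² terms,
  -- which explains the constant 3.
  have hterm : ∀ i j k l, ∫ ω, h (X i ω) (X j ω) * h (X k ω) (X l ω) ∂μ
      ≤ C ^ 2 * (δ i j * δ k l + δ i k * δ j l + δ i l * δ j k) := by
    intro i j k l
    by_cases hp : (i = j ∧ k = l) ∨ (i = k ∧ j = l) ∨ (i = l ∧ j = k)
    · have h1 : 1 ≤ δ i j * δ k l + δ i k * δ j l + δ i l * δ j k := by
        have e1 := mul_nonneg (hδ i j) (hδ k l)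
        have e2 := mul_nonneg (hδ i k) (hδ j l)
        have e3 := mul_nonneg (hδ i l) (hδ j k)
        rcases hp with ⟨a, b⟩ | ⟨a, b⟩ | ⟨a, b⟩
        · have : δ i j * δ k l = 1 := by simp [δ, a, b]
          linarith
        · have : δ i k * δ j l = 1 := by simp [δ, a, b]
          linarith
        · have : δ i l * δ j k = 1 := by simp [δ, a, b]
          linarith
      calc ∫ ω, h (X i ω) (X j ω) * h (X k ω) (X l ω) ∂μ ≤ ∫ _, C ^ 2 ∂μ :=
            integral_mono (hint i j k l) (integrable_const _) fun ω => le_of_abs_le (hb i j k l ω)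
        _ = C ^ 2 * 1 := by simp
        _ ≤ _ := mul_le_mul_of_nonneg_left h1 (sq_nonneg C)
    · have hz : ∫ ω, h (X i ω) (X j ω) * h (X k ω) (X l ω) ∂μ = 0 := by
        have hcase : (i ≠ j ∧ i ≠ k ∧ i ≠ l) ∨ (j ≠ i ∧ j ≠ k ∧ j ≠ l) ∨ (k ≠ l ∧ k ≠ i ∧ k ≠ j) ∨
            (l ≠ k ∧ l ≠ i ∧ l ≠ j) := by omega
        have hzero {a b c d : ℕ} (h : a ≠ b ∧ a ≠ c ∧ a ≠ d) :=
          integral_kernel_mul_kernel_eq_zero hindep hlaw hh hC h0 h.1 h.2.1 h.2.2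
        rcases hcase with hc | hc | hc | hc
        · exact hzero hc
        · simpa only [hsymm] using hzero hc
        · simpa only [mul_comm] using hzero hc
        · rw [← hzero hc]
          congr 1; ext ω
          rw [hsymm (X l ω), mul_comm]
      rw [hz]
      exact mul_nonneg (sq_nonneg C) (add_nonneg (add_nonneg (mul_nonneg (hδ _ _) (hδ _ _))
        (mul_nonneg (hδ _ _) (hδ _ _))) (mul_nonneg (hδ _ _) (hδ _ _)))
  have hexp : ∫ ω, (∑ i ∈ Finset.range n, ∑ j ∈ Finset.range n, h (X i ω) (X j ω)) ^ 2 ∂μ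
      = ∑ i ∈ Finset.range n, ∑ k ∈ Finset.range n, ∑ j ∈ Finset.range n, ∑ l ∈ Finset.range n,
        ∫ ω, h (X i ω) (X j ω) * h (X k ω) (X l ω) ∂μ := by
    simp only [sq, Finset.sum_mul_sum]
    rw [integral_finsetSum _ fun i _ => integrable_finsetSum _ fun k _ =>
      integrable_finsetSum _ fun j _ => integrable_finsetSum _ fun l _ => hint i j k l]
    refine Finset.sum_congr rfl fun i _ => ?_
    rw [integral_finsetSum _ fun k _ =>
      integrable_finsetSum _ fun j _ => integrable_finsetSum _ fun l _ => hint i j k l]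
    refine Finset.sum_congr rfl fun k _ => ?_
    rw [integral_finsetSum _ fun j _ => integrable_finsetSum _ fun l _ => hint i j k l]
    refine Finset.sum_congr rfl fun j _ => ?_
    rw [integral_finsetSum _ fun l _ => hint i j k l]
  rw [hexp]
  calc _ ≤ ∑ i ∈ Finset.range n, ∑ k ∈ Finset.range n, ∑ j ∈ Finset.range n,
        ∑ l ∈ Finset.range n, C ^ 2 * (δ i j * δ k l + δ i k * δ j l + δ i l * δ j k) :=
      Finset.sum_le_sum fun i _ => Finset.sum_le_sum fun k _ => Finset.sum_le_sum fun j _ =>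
        Finset.sum_le_sum fun l _ => hterm i j k l
    _ = 3 * C ^ 2 * n ^ 2 := by
      have hrow : ∀ a ∈ Finset.range n, ∑ b ∈ Finset.range n, δ a b = 1 := fun a ha => by
        simp [δ, Finset.mem_range.1 ha]
      simp only [← Finset.mul_sum, Finset.sum_add_distrib]
      have s1 : ∑ i ∈ Finset.range n, ∑ k ∈ Finset.range n, ∑ j ∈ Finset.range n,
          ∑ l ∈ Finset.range n, δ i j * δ k l = (n : ℝ) ^ 2 := by
        calc _ = ∑ i ∈ Finset.range n, ∑ k ∈ Finset.range n, (1 : ℝ) := by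
              refine Finset.sum_congr rfl fun i hi => Finset.sum_congr rfl fun k hk => ?_
              rw [← Finset.sum_mul_sum, hrow i hi, hrow k hk, one_mul]
          _ = (n : ℝ) ^ 2 := by simp [sq]
      have s2 : ∑ i ∈ Finset.range n, ∑ k ∈ Finset.range n, ∑ j ∈ Finset.range n,
          ∑ l ∈ Finset.range n, δ i k * δ j l = (n : ℝ) ^ 2 := by
        simp only [← Finset.mul_sum, ← Finset.sum_mul]
        rw [Finset.sum_congr rfl hrow]
        simp [sq]
      have s3 : ∑ i ∈ Finset.range n, ∑ k ∈ Finset.range n, ∑ j ∈ Finset.range n,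
          ∑ l ∈ Finset.range n, δ i l * δ j k = (n : ℝ) ^ 2 := by
        calc _ = ∑ i ∈ Finset.range n, ∑ k ∈ Finset.range n, (1 : ℝ) := by
              refine Finset.sum_congr rfl fun i hi => Finset.sum_congr rfl fun k hk => ?_
              rw [Finset.sum_comm, ← Finset.sum_mul_sum, hrow i hi]
              simp [δ, Finset.mem_range.1 hk]
          _ = (n : ℝ) ^ 2 := by simp [sq]
      simp only [Finset.mul_sum] at s1 s2 s3 ⊢
      rw [s1, s2, s3]
      ring

end SecondMoments

/-! ### Population quantities: the pair kernel, the influence function and Δ. -/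

noncomputable section Population

variable {q : ℕ}

theorem ind_pos {p : Prop} (h : p) : ind p = 1 := by simp [ind, h]

theorem ind_neg {p : Prop} (h : ¬p) : ind p = 0 := by simp [ind, h]

theorem ind_nonneg (p : Prop) : 0 ≤ ind p := by
  by_cases h : p <;> simp [ind, h]

theorem ind_le_one (p : Prop) : ind p ≤ 1 := by
  by_cases h : p <;> simp [ind, h]

theorem ind_mul_self (p : Prop) : ind p * ind p = ind p := by
  by_cases h : p <;> simp [ind, h]

theorem ind_and (p r : Prop) : ind (p ∧ r) = ind p * ind r := by
  by_cases h : p <;> by_cases h' : r <;> simp [ind, h, h']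

theorem measurable_ind {α : Type*} [MeasurableSpace α] {p : α → Prop}
    (hp : MeasurableSet {x | p x}) : Measurable fun x => ind (p x) := by
  classical
  have : (fun x => ind (p x)) = {x | p x}.indicator fun _ => (1 : ℝ) := by
    ext x
    simp [ind, Set.indicator_apply]
  rw [this]
  exact measurable_const.indicator hp

theorem integral_ind {α : Type*} [MeasurableSpace α] (ν : Measure α) {p : α → Prop}
    (hp : MeasurableSet {x | p x}) : ∫ x, ind (p x) ∂ν = ν.real {x | p x} := by
  classical
  have : (fun x => ind (p x)) = {x | p x}.indicator fun _ => (1 : ℝ) := by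
    ext x
    simp [ind, Set.indicator_apply]
  rw [this, integral_indicator_const _ hp]
  simp

theorem measurable_coordJ : Measurable (coordJ : (Fin (q + 2) → ℝ) → Fin q → ℝ) :=
  measurable_pi_lambda _ fun _ => measurable_pi_apply _

theorem measurableSet_coordJ {A : Set (Fin q → ℝ)} (hA : MeasurableSet A) :
    MeasurableSet {x : Fin (q + 2) → ℝ | coordJ x ∈ A} := measurable_coordJ hA

theorem measurable_ind_coordJ {A : Set (Fin q → ℝ)} (hA : MeasurableSet A) :
    Measurable fun x : Fin (q + 2) → ℝ => ind (coordJ x ∈ A) :=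
  measurable_ind (measurableSet_coordJ hA)

theorem measurableSet_setOf_lt {r : Fin (q + 2)} :
    MeasurableSet {z : (Fin (q + 2) → ℝ) × (Fin (q + 2) → ℝ) | z.1 r < z.2 r} :=
  measurableSet_lt (by fun_prop) (by fun_prop)

theorem measurableSet_lt_and_lt :
    MeasurableSet {z : (Fin (q + 2) → ℝ) × (Fin (q + 2) → ℝ) | z.1 0 < z.2 0 ∧ z.1 1 < z.2 1} :=
  measurableSet_setOf_lt.inter measurableSet_setOf_lt

theorem measurable_concKernel :
    Measurable (Function.uncurry (concKernel : (Fin (q + 2) → ℝ) → (Fin (q + 2) → ℝ) → ℝ)) := by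
  have h1 : Measurable fun z : (Fin (q + 2) → ℝ) × (Fin (q + 2) → ℝ) =>
    ind (z.1 0 < z.2 0 ∧ z.1 1 < z.2 1) := measurable_ind measurableSet_lt_and_lt
  exact (h1.add (h1.comp measurable_swap)).div_const 2

theorem concKernel_comm (x y : Fin (q + 2) → ℝ) : concKernel x y = concKernel y x := by
  simp only [concKernel]; ring

theorem concKernel_nonneg (x y : Fin (q + 2) → ℝ) : 0 ≤ concKernel x y := by
  have h1 := ind_nonneg (x 0 < y 0 ∧ x 1 < y 1)
  have h2 := ind_nonneg (y 0 < x 0 ∧ y 1 < x 1)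
  simp only [concKernel]; linarith

theorem concKernel_le_one (x y : Fin (q + 2) → ℝ) : concKernel x y ≤ 1 := by
  have h1 := ind_le_one (x 0 < y 0 ∧ x 1 < y 1)
  have h2 := ind_le_one (y 0 < x 0 ∧ y 1 < x 1)
  simp only [concKernel]; linarith

/-- The concordance kernel restricted to pairs with both conditioning parts in `A`. -/
def pairKernel (A : Set (Fin q → ℝ)) (x y : Fin (q + 2) → ℝ) : ℝ :=
  ind (coordJ x ∈ A) * ind (coordJ y ∈ A) * concKernel x y

theorem pairKernel_comm (A : Set (Fin q → ℝ)) (x y : Fin (q + 2) → ℝ) :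
    pairKernel A x y = pairKernel A y x := by
  simp only [pairKernel, concKernel_comm x y]; ring

theorem pairKernel_nonneg (A : Set (Fin q → ℝ)) (x y : Fin (q + 2) → ℝ) :
    0 ≤ pairKernel A x y :=
  mul_nonneg (mul_nonneg (ind_nonneg _) (ind_nonneg _)) (concKernel_nonneg x y)

theorem pairKernel_le_one (A : Set (Fin q → ℝ)) (x y : Fin (q + 2) → ℝ) :
    pairKernel A x y ≤ 1 :=
  mul_le_one₀ (mul_le_one₀ (ind_le_one _) (ind_nonneg _) (ind_le_one _)) (concKernel_nonneg x y)
    (concKernel_le_one x y)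

theorem measurable_pairKernel {A : Set (Fin q → ℝ)} (hA : MeasurableSet A) :
    Measurable (Function.uncurry (pairKernel A)) :=
  (((measurable_ind_coordJ hA).comp measurable_fst).mul
    ((measurable_ind_coordJ hA).comp measurable_snd)).mul measurable_concKernel

/-- The conditional mean `∫ π(y, x) ℙ_A(dy)`. -/
def condMean (P : Measure (Fin (q + 2) → ℝ)) (A : Set (Fin q → ℝ)) (x : Fin (q + 2) → ℝ) : ℝ :=
  ∫ y, concKernel y x ∂(condLaw P A)

/-- The influence function of the conditional Kendall's tau given `X_J ∈ A`. -/
def influence (P : Measure (Fin (q + 2) → ℝ)) (A : Set (Fin q → ℝ)) (x : Fin (q + 2) → ℝ) : ℝ :=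
  8 * (ind (coordJ x ∈ A) * condMean P A x / prob P A
    - concD P A * ind (coordJ x ∈ A) / prob P A ^ 3)

variable {P : Measure (Fin (q + 2) → ℝ)} {A : Set (Fin q → ℝ)}

instance (P : Measure (Fin (q + 2) → ℝ)) (A : Set (Fin q → ℝ)) :
    IsZeroOrProbabilityMeasure (condLaw P A) :=
  inferInstanceAs (IsZeroOrProbabilityMeasure (P[|_]))

theorem prob_pos [IsProbabilityMeasure P] (hpos : 0 < P {x | coordJ x ∈ A}) : 0 < prob P A :=
  ENNReal.toReal_pos hpos.ne' (measure_ne_top _ _)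

theorem integral_condLaw (hA : MeasurableSet A) (f : (Fin (q + 2) → ℝ) → ℝ) :
    ∫ x, f x ∂(condLaw P A) = (prob P A)⁻¹ * ∫ x, ind (coordJ x ∈ A) * f x ∂P := by
  classical
  rw [condLaw, ProbabilityTheory.cond, integral_smul_measure, ENNReal.toReal_inv,
    ← integral_indicator (measurableSet_coordJ hA), smul_eq_mul, prob, measureReal_def]
  congr 2
  ext x
  by_cases h : coordJ x ∈ A <;> simp [ind, h]

theorem measurable_condMean : Measurable (condMean P A) := by
  exact measurable_concKernel.stronglyMeasurable.integral_prod_left'.measurable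

theorem abs_condMean_le_one (x : Fin (q + 2) → ℝ) : |condMean P A x| ≤ 1 := by
  have h := norm_integral_le_of_norm_le_const (μ := condLaw P A) (f := fun y => concKernel y x)
    (C := 1) (ae_of_all _ fun y => by
      rw [Real.norm_of_nonneg (concKernel_nonneg _ _)]; exact concKernel_le_one _ _)
  refine h.trans ?_
  rw [one_mul]
  exact measureReal_le_one

/-- The factor p undoes the normalization of the conditional law. This is the first-order projection
used in the Hoeffding decomposition. -/
theorem integral_pairKernel (hA : MeasurableSet A) (hpos : 0 < prob P A)
    (y : Fin (q + 2) → ℝ) :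
    ∫ x, pairKernel A x y ∂P = prob P A * (ind (coordJ y ∈ A) * condMean P A y) := by
  rw [condMean, integral_condLaw hA, mul_left_comm, mul_inv_cancel_left₀ hpos.ne',
    ← integral_const_mul]
  congr 1; ext x; simp only [pairKernel]; ring

theorem integrable_pairKernel [IsProbabilityMeasure P] (hA : MeasurableSet A) :
    Integrable (Function.uncurry (pairKernel A)) (P.prod P) :=
  Integrable.of_bound (measurable_pairKernel hA).aestronglyMeasurable 1 (ae_of_all _ fun z => by
    simp only [Function.uncurry]
    rw [Real.norm_of_nonneg (pairKernel_nonneg _ _ _)]; exact pairKernel_le_one _ _ _)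

theorem measurableSet_concD (hA : MeasurableSet A) :
    MeasurableSet {z : (Fin (q + 2) → ℝ) × (Fin (q + 2) → ℝ) |
      z.1 0 < z.2 0 ∧ z.1 1 < z.2 1 ∧ coordJ z.1 ∈ A ∧ coordJ z.2 ∈ A} := by
  exact measurableSet_setOf_lt.inter (measurableSet_setOf_lt.inter
      ((measurable_coordJ.comp measurable_fst hA).inter (measurable_coordJ.comp measurable_snd hA)))

theorem integral_ind_concD (hA : MeasurableSet A) :
    ∫ z, ind (z.1 0 < z.2 0 ∧ z.1 1 < z.2 1 ∧ coordJ z.1 ∈ A ∧ coordJ z.2 ∈ A) ∂(P.prod P)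
      = concD P A := integral_ind _ (measurableSet_concD hA)

/-- The two halves of the symmetrized kernel are exchanged by swapping the coordinates, which
preserves the product measure, so each has integral D. -/
theorem integral_prod_pairKernel [IsProbabilityMeasure P] (hA : MeasurableSet A) :
    ∫ z, pairKernel A z.1 z.2 ∂(P.prod P) = concD P A := by
  have hm := measurable_ind (measurableSet_concD hA)
  have hi : Integrable (fun z : (Fin (q + 2) → ℝ) × (Fin (q + 2) → ℝ) =>
      ind (z.1 0 < z.2 0 ∧ z.1 1 < z.2 1 ∧ coordJ z.1 ∈ A ∧ coordJ z.2 ∈ A)) (P.prod P) :=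
    Integrable.of_bound hm.aestronglyMeasurable 1 (ae_of_all _ fun z => by
      rw [Real.norm_of_nonneg (ind_nonneg _)]; exact ind_le_one _)
  have hsw := integral_prod_swap (μ := P) (ν := P)
    (f := fun z : (Fin (q + 2) → ℝ) × (Fin (q + 2) → ℝ) =>
      ind (z.1 0 < z.2 0 ∧ z.1 1 < z.2 1 ∧ coordJ z.1 ∈ A ∧ coordJ z.2 ∈ A))
  have hadd := integral_add hi hi.swap
  simp only [Function.comp_apply] at hadd
  rw [hsw, integral_ind_concD hA] at hadd
  have h2 : ∫ z, pairKernel A z.1 z.2 ∂(P.prod P) = (concD P A + concD P A) / 2 := by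
    rw [← hadd, ← integral_div]
    congr 1; ext z
    simp only [pairKernel, concKernel, ind_and, Prod.fst_swap, Prod.snd_swap]
    ring
  rw [h2]; ring

theorem integral_ind_mul_condMean [IsProbabilityMeasure P] (hA : MeasurableSet A) (hpos : 0 < prob P A) :
    ∫ x, ind (coordJ x ∈ A) * condMean P A x ∂P = concD P A / prob P A := by
  have h := integral_prod_symm _ (integrable_pairKernel (P := P) hA)
  simp only [Function.uncurry, integral_pairKernel hA hpos] at h
  rw [integral_prod_pairKernel hA, integral_const_mul] at h
  rw [h, mul_div_cancel_left₀ _ hpos.ne']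

theorem measurable_influence (hA : MeasurableSet A) : Measurable (influence P A) := by
  have h1 := measurable_ind_coordJ hA
  have h2 := measurable_condMean (P := P) (A := A)
  unfold influence
  fun_prop

theorem integrable_of_abs_le_one [IsProbabilityMeasure P] {f : (Fin (q + 2) → ℝ) → ℝ} (hf : Measurable f)
    (h : ∀ x, |f x| ≤ 1) : Integrable f P :=
  Integrable.of_bound hf.aestronglyMeasurable 1 (ae_of_all _ h)

theorem abs_ind_mul_le (p : Prop) {a : ℝ} (ha : |a| ≤ 1) : |ind p * a| ≤ 1 := by
  rw [abs_mul, abs_of_nonneg (ind_nonneg p)]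
  exact mul_le_one₀ (ind_le_one p) (abs_nonneg _) ha

theorem memLp_influence [IsProbabilityMeasure P] (hA : MeasurableSet A) : MemLp (influence P A) 2 P := by
  have h1 := measurable_ind_coordJ hA
  have h2 := measurable_condMean (P := P) (A := A)
  have m1 : MemLp (fun x => ind (coordJ x ∈ A) * condMean P A x) 2 P :=
    MemLp.of_bound (h1.mul h2).aestronglyMeasurable 1
      (ae_of_all _ fun x => abs_ind_mul_le _ (abs_condMean_le_one x))
  have m2 : MemLp (fun x : Fin (q + 2) → ℝ => ind (coordJ x ∈ A)) 2 P :=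
    MemLp.of_bound h1.aestronglyMeasurable 1 (ae_of_all _ fun x => by
      rw [Real.norm_of_nonneg (ind_nonneg _)]; exact ind_le_one _)
  have := ((m1.mul_const (prob P A)⁻¹).sub
    ((m2.const_mul (concD P A)).mul_const (prob P A ^ 3)⁻¹)).const_mul 8
  exact this

theorem integral_influence [IsProbabilityMeasure P] (hA : MeasurableSet A) (hpos : 0 < prob P A) :
    ∫ x, influence P A x ∂P = 0 := by
  have h1 := measurable_ind_coordJ hA
  have h2 := measurable_condMean (P := P) (A := A)
  have i1 : Integrable (fun x => ind (coordJ x ∈ A) * condMean P A x) P :=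
    integrable_of_abs_le_one (h1.mul h2) fun x => abs_ind_mul_le _ (abs_condMean_le_one x)
  have i2 : Integrable (fun x : Fin (q + 2) → ℝ => ind (coordJ x ∈ A)) P :=
    integrable_of_abs_le_one h1 fun x => by
      rw [abs_of_nonneg (ind_nonneg _)]; exact ind_le_one _
  simp only [influence]
  rw [integral_const_mul, integral_sub (i1.div_const _) ((i2.const_mul _).div_const _),
    integral_div, integral_div, integral_const_mul, integral_ind_mul_condMean hA hpos,
    integral_ind _ (measurableSet_coordJ hA)]
  change 8 * (concD P A / prob P A / prob P A - concD P A * prob P A / prob P A ^ 3) = 0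
  field_simp
  ring

/-- For fixed x₃ the integrand is a product of a function of x₁ and a function of x₂, so the double
integral factors into conditional means. -/
theorem coefI_eq (P : Measure (Fin (q + 2) → ℝ)) (A B : Set (Fin q → ℝ)) :
    coefI P A B = ∫ x, ind (coordJ x ∈ A ∩ B) * (condMean P A x * condMean P B x) ∂P := by
  simp only [coefI, condMean]
  congr 1; ext x
  simp only [integral_const_mul, integral_mul_const]
  ring

theorem coefJ_eq (P : Measure (Fin (q + 2) → ℝ)) (A B : Set (Fin q → ℝ)) :
    coefJ P A B = ∫ x, ind (coordJ x ∈ A ∩ B) * condMean P A x ∂P := by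
  simp only [coefJ, condMean, integral_const_mul]

/-- The entries of the limit covariance matrix are the second moments of influence functions. -/
theorem limitCov_eq [IsProbabilityMeasure P] {m : ℕ} (A : Fin m → Set (Fin q → ℝ)) (hA : ∀ k, MeasurableSet (A k)) :
    limitCov P A = Matrix.of fun k l => ∫ x, influence P (A k) x * influence P (A l) x ∂P := by
  ext k l
  have hkl := measurable_ind_coordJ ((hA k).inter (hA l))
  have gk := measurable_condMean (P := P) (A := A k)
  have gl := measurable_condMean (P := P) (A := A l)
  have i1 : Integrable (fun x => ind (coordJ x ∈ A k ∩ A l) *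
      (condMean P (A k) x * condMean P (A l) x)) P :=
    integrable_of_abs_le_one (hkl.mul (gk.mul gl)) fun x => abs_ind_mul_le _ (by
      rw [abs_mul]
      exact mul_le_one₀ (abs_condMean_le_one x) (abs_nonneg _) (abs_condMean_le_one x))
  have i2 : Integrable (fun x => ind (coordJ x ∈ A k ∩ A l) * condMean P (A k) x) P :=
    integrable_of_abs_le_one (hkl.mul gk) fun x => abs_ind_mul_le _ (abs_condMean_le_one x)
  have i3 : Integrable (fun x => ind (coordJ x ∈ A k ∩ A l) * condMean P (A l) x) P :=
    integrable_of_abs_le_one (hkl.mul gl) fun x => abs_ind_mul_le _ (abs_condMean_le_one x)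
  have i4 : Integrable (fun x : Fin (q + 2) → ℝ => ind (coordJ x ∈ A k ∩ A l)) P :=
    integrable_of_abs_le_one hkl fun x => by
      rw [abs_of_nonneg (ind_nonneg _)]; exact ind_le_one _
  have j14 := Integrable.fun_add (i1.div_const (prob P (A k) * prob P (A l)))
    ((i4.const_mul (concD P (A k) * concD P (A l))).div_const (prob P (A k) ^ 3 * prob P (A l) ^ 3))
  have hp : prob P (A k ∩ A l) = ∫ x, ind (coordJ x ∈ A k ∩ A l) ∂P :=
    (integral_ind _ (measurableSet_coordJ ((hA k).inter (hA l)))).symm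
  simp only [limitCov, Matrix.of_apply]
  -- The four terms of Δ are gathered under one integral; pointwise they are the four terms of the
  -- expanded product of two influence functions, with 64 = 8 · 8.
  rw [coefI_eq, coefJ_eq, coefJ_eq, Set.inter_comm (A l) (A k), hp, ← integral_div, ← integral_const_mul,
    ← integral_div, ← integral_const_mul, ← integral_div, ← integral_const_mul, ← integral_div,
    ← integral_add (i1.div_const _) ((i4.const_mul _).div_const _),
    ← integral_sub j14 ((i2.const_mul _).div_const _)]
  refine (congrArg (64 * ·) (integral_sub (j14.sub ((i2.const_mul _).div_const _))
    ((i3.const_mul _).div_const _)).symm).trans ((integral_const_mul _ _).symm.trans ?_)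
  congr 1; ext x
  simp only [Pi.sub_apply]
  rw [show ind (coordJ x ∈ A k ∩ A l) = ind (coordJ x ∈ A k) * ind (coordJ x ∈ A l) from
    ind_and _ _]
  simp only [influence]
  ring

end Population

/-! ### Absence of ties and the population formula for Kendall's tau. -/

noncomputable section Ties

variable {q : ℕ} {P : Measure (Fin (q + 2) → ℝ)} [IsProbabilityMeasure P] {A : Set (Fin q → ℝ)}

/-- The mass of a point is the jump of the distribution function there. -/
theorem measure_singleton_eq_zero_of_continuous_cdf (ν : Measure ℝ) [IsProbabilityMeasure ν]
    (hν : Continuous (cdf ν)) (a : ℝ) : ν {a} = 0 := by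
  have h : Function.leftLim (cdf ν) a = cdf ν a :=
    leftLim_eq_of_tendsto (hν.continuousAt.tendsto.mono_left nhdsWithin_le_nhds)
  rw [← measure_cdf ν, StieltjesFunction.measure_singleton, h, sub_self, ENNReal.ofReal_zero]

/-- Two independent observations with conditioning parts in `A` almost surely have no tie in a
coordinate whose conditional distribution function is continuous. -/
theorem ae_prod_ne (hA : MeasurableSet A) (hpos : 0 < P {x | coordJ x ∈ A}) {r : Fin (q + 2)}
    (hc : Continuous (cdf ((condLaw P A).map fun x => x r))) :
    ∀ᵐ z ∂(P.prod P), coordJ z.1 ∈ A → coordJ z.2 ∈ A → z.1 r ≠ z.2 r := by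
  have hprob : IsProbabilityMeasure (condLaw P A) := cond_isProbabilityMeasure hpos.ne'
  have hmr : Measurable fun x : Fin (q + 2) → ℝ => x r := measurable_pi_apply r
  have : IsProbabilityMeasure ((condLaw P A).map fun x => x r) :=
    Measure.isProbabilityMeasure_map hmr.aemeasurable
  have hset : MeasurableSet {z : (Fin (q + 2) → ℝ) × (Fin (q + 2) → ℝ) |
      coordJ z.1 ∈ A ∧ coordJ z.2 ∈ A ∧ z.1 r = z.2 r} :=
    (measurable_coordJ.comp measurable_fst hA).inter
      ((measurable_coordJ.comp measurable_snd hA).inter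
        (measurableSet_eq_fun (hmr.comp measurable_fst) (hmr.comp measurable_snd)))
  have hnull : (P.prod P) {z | coordJ z.1 ∈ A ∧ coordJ z.2 ∈ A ∧ z.1 r = z.2 r} = 0 := by
    rw [Measure.measure_prod_null hset]
    refine ae_of_all _ fun x => ?_
    have h1 := measure_singleton_eq_zero_of_continuous_cdf _ hc (x r)
    rw [Measure.map_apply hmr (measurableSet_singleton _), condLaw,
      cond_apply (measurableSet_coordJ hA)] at h1
    have h2 : P ({x | coordJ x ∈ A} ∩ (fun y => y r) ⁻¹' {x r}) = 0 :=
      (mul_eq_zero.1 h1).resolve_left (ENNReal.inv_ne_zero.2 (measure_ne_top _ _))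
    refine measure_mono_null ?_ h2
    rintro y ⟨-, h3, h4⟩
    exact ⟨h3, h4.symm⟩
  rw [ae_iff]
  refine measure_mono_null (fun z hz => ?_) hnull
  simpa using hz

/-- A product is positive exactly when both differences have the same strict sign, and the two cases
exclude each other. Ties do no harm here, unlike for discordance. -/
theorem ind_concordant (x y : Fin (q + 2) → ℝ) :
    ind (0 < (x 0 - y 0) * (x 1 - y 1)) = 2 * concKernel x y := by
  rw [concKernel, mul_div_cancel₀ _ two_ne_zero]
  by_cases h1 : x 0 < y 0 ∧ x 1 < y 1
  · have h2 : ¬(y 0 < x 0 ∧ y 1 < x 1) := fun h => lt_asymm h.1 h1.1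
    rw [ind_pos h1, ind_neg h2, ind_pos, add_zero]
    exact mul_pos_of_neg_of_neg (by linarith [h1.1]) (by linarith [h1.2])
  · by_cases h2 : y 0 < x 0 ∧ y 1 < x 1
    · rw [ind_neg h1, ind_pos h2, ind_pos, zero_add]
      exact mul_pos (by linarith [h2.1]) (by linarith [h2.2])
    · rw [ind_neg h1, ind_neg h2, ind_neg, add_zero]
      intro h
      rcases mul_pos_iff.1 h with ⟨a, b⟩ | ⟨a, b⟩
      · exact h2 ⟨by linarith, by linarith⟩
      · exact h1 ⟨by linarith, by linarith⟩

theorem ind_discordant {x y : Fin (q + 2) → ℝ} (h0 : x 0 ≠ y 0) (h1 : x 1 ≠ y 1) :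
    ind ((x 0 - y 0) * (x 1 - y 1) < 0) = 1 - 2 * concKernel x y := by
  rw [← ind_concordant]
  rcases lt_or_gt_of_ne (mul_ne_zero (sub_ne_zero.2 h0) (sub_ne_zero.2 h1)) with h | h
  · rw [ind_pos h, ind_neg (not_lt.2 h.le), sub_zero]
  · rw [ind_pos h, ind_neg (not_lt.2 h.le), sub_self]

/-- Kendall's tau in terms of the probability of concordance. -/
theorem tau_eq (hA : MeasurableSet A) (hpos : 0 < P {x | coordJ x ∈ A})
    (hc0 : Continuous (cdf ((condLaw P A).map fun x => x 0)))
    (hc1 : Continuous (cdf ((condLaw P A).map fun x => x 1))) :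
    tau P A = 4 * concD P A / prob P A ^ 2 - 1 := by
  have hp := prob_pos hpos
  have hS : MeasurableSet {z : (Fin (q + 2) → ℝ) × (Fin (q + 2) → ℝ) |
      coordJ z.1 ∈ A ∧ coordJ z.2 ∈ A} :=
    (measurable_coordJ.comp measurable_fst hA).inter (measurable_coordJ.comp measurable_snd hA)
  have hf : Measurable fun z : (Fin (q + 2) → ℝ) × (Fin (q + 2) → ℝ) =>
      (z.1 0 - z.2 0) * (z.1 1 - z.2 1) := by fun_prop
  have hC := measurableSet_lt (measurable_const (a := (0 : ℝ))) hf
  have hD := measurableSet_lt hf (measurable_const (a := (0 : ℝ)))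
  have hSp : (P.prod P).real {z | coordJ z.1 ∈ A ∧ coordJ z.2 ∈ A} = prob P A ^ 2 := by
    rw [prob, sq, ← measureReal_prod_prod]
    rfl
  have hii : Integrable (fun z : (Fin (q + 2) → ℝ) × (Fin (q + 2) → ℝ) =>
      ind (coordJ z.1 ∈ A ∧ coordJ z.2 ∈ A)) (P.prod P) :=
    Integrable.of_bound (measurable_ind hS).aestronglyMeasurable 1 (ae_of_all _ fun z => by
      rw [Real.norm_of_nonneg (ind_nonneg _)]; exact ind_le_one _)
  have hiS : ∫ z, ind (coordJ z.1 ∈ A ∧ coordJ z.2 ∈ A) ∂(P.prod P) = prob P A ^ 2 := by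
    rw [integral_ind _ hS, hSp]
  have hk : Integrable (fun z => pairKernel A z.1 z.2) (P.prod P) := integrable_pairKernel hA
  have e1 : (P.prod P).real ({z | coordJ z.1 ∈ A ∧ coordJ z.2 ∈ A} ∩
      {z | 0 < (z.1 0 - z.2 0) * (z.1 1 - z.2 1)}) = 2 * concD P A := by
    rw [← integral_prod_pairKernel hA, ← integral_const_mul]
    refine (integral_ind (P.prod P) (hS.inter hC)).symm.trans ?_
    congr 1; ext z
    refine (ind_and (coordJ z.1 ∈ A ∧ coordJ z.2 ∈ A)
      (0 < (z.1 0 - z.2 0) * (z.1 1 - z.2 1))).trans ?_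
    rw [ind_concordant, ind_and, pairKernel]
    ring
  -- Only the discordant mass needs continuity: almost surely on this event, discordance is the
  -- complement of concordance.
  have e2 : (P.prod P).real ({z | coordJ z.1 ∈ A ∧ coordJ z.2 ∈ A} ∩
      {z | (z.1 0 - z.2 0) * (z.1 1 - z.2 1) < 0}) = prob P A ^ 2 - 2 * concD P A := by
    rw [← integral_prod_pairKernel hA, ← integral_const_mul, ← hiS,
      ← integral_sub hii (hk.const_mul 2)]
    refine (integral_ind (P.prod P) (hS.inter hD)).symm.trans (integral_congr_ae ?_)
    filter_upwards [ae_prod_ne hA hpos hc0, ae_prod_ne hA hpos hc1] with z h0 h1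
    refine (ind_and (coordJ z.1 ∈ A ∧ coordJ z.2 ∈ A)
      ((z.1 0 - z.2 0) * (z.1 1 - z.2 1) < 0)).trans ?_
    rw [pairKernel]
    by_cases hz : coordJ z.1 ∈ A ∧ coordJ z.2 ∈ A
    · rw [ind_discordant (h0 hz.1 hz.2) (h1 hz.1 hz.2), ind_pos hz, ind_pos hz.1, ind_pos hz.2]
      ring
    · rw [← ind_and (coordJ z.1 ∈ A) (coordJ z.2 ∈ A), ind_neg hz]; ring
  have hcond : ∀ t : Set ((Fin (q + 2) → ℝ) × (Fin (q + 2) → ℝ)),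
      ((P.prod P)[|{z | coordJ z.1 ∈ A ∧ coordJ z.2 ∈ A}]).real t = (prob P A ^ 2)⁻¹ *
        (P.prod P).real ({z | coordJ z.1 ∈ A ∧ coordJ z.2 ∈ A} ∩ t) := fun t => by
    rw [measureReal_def, cond_apply hS, ENNReal.toReal_mul, ENNReal.toReal_inv, ← hSp]
    rfl
  rw [tau, hcond, hcond, e1, e2]
  field_simp
  ring

end Ties

/-! ### Deterministic comparison of the estimators and Taylor expansion of v/u². -/

noncomputable section Sample

variable {q : ℕ} {A : Set (Fin q → ℝ)} {n : ℕ} {x : ℕ → Fin (q + 2) → ℝ}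

/-- The sum of the concordance kernel over all pairs of the subsample. -/
def pairSum (A : Set (Fin q → ℝ)) (n : ℕ) (x : ℕ → Fin (q + 2) → ℝ) : ℝ :=
  ∑ i ∈ Finset.range n, ∑ j ∈ Finset.range n, pairKernel A (x i) (x j)

/-- The sample has no ties in the first two coordinates among the points of the subsample. -/
def NoTies (A : Set (Fin q → ℝ)) (x : ℕ → Fin (q + 2) → ℝ) : Prop :=
  ∀ i j, i ≠ j → coordJ (x i) ∈ A → coordJ (x j) ∈ A → x i 0 ≠ x j 0 ∧ x i 1 ≠ x j 1

theorem weight_mul_weight (i j : ℕ) : weight A n x i * weight A n x j =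
    ind (coordJ (x i) ∈ A) * ind (coordJ (x j) ∈ A) / subsampleSize A n x ^ 2 := by
  simp only [weight]; rw [div_mul_div_comm, sq]

theorem sum_sum_symmetrize (f : ℕ → ℕ → ℝ) :
    ∑ i ∈ Finset.range n, ∑ j ∈ Finset.range n, f i j
      = ∑ i ∈ Finset.range n, ∑ j ∈ Finset.range n, (f i j + f j i) / 2 := by
  have h : ∑ i ∈ Finset.range n, ∑ j ∈ Finset.range n, f i j
      = ∑ i ∈ Finset.range n, ∑ j ∈ Finset.range n, f j i := Finset.sum_comm
  simp only [← Finset.sum_div, Finset.sum_add_distrib]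
  rw [← h]; ring

/-- No assumption on ties or on N is needed: for N = 0 both sides equal -1, since division by zero
gives 0. -/
theorem tauHat1_eq (A : Set (Fin q → ℝ)) (n : ℕ) (x : ℕ → Fin (q + 2) → ℝ) :
    tauHat1 A n x = 4 * (pairSum A n x / subsampleSize A n x ^ 2) - 1 := by
  rw [tauHat1, sum_sum_symmetrize, pairSum]
  simp only [Finset.sum_div]
  congr 2
  refine Finset.sum_congr rfl fun i _ => Finset.sum_congr rfl fun j _ => ?_
  simp only [weight_mul_weight, pairKernel, concKernel]
  ring

theorem sumSqWeight_eq (hN : subsampleSize A n x ≠ 0) :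
    sumSqWeight A n x = (subsampleSize A n x)⁻¹ := by
  simp only [sumSqWeight, weight, div_pow, sq (ind _), ind_mul_self]
  rw [← Finset.sum_div]
  change subsampleSize A n x / _ = _
  field_simp

theorem sum_weight (hN : subsampleSize A n x ≠ 0) :
    ∑ i ∈ Finset.range n, weight A n x i = 1 := by
  simp only [weight]
  rw [← Finset.sum_div]
  exact div_self hN

theorem sum_sum_weight (hN : subsampleSize A n x ≠ 0) :
    ∑ i ∈ Finset.range n, ∑ j ∈ Finset.range n, weight A n x i * weight A n x j = 1 := by
  rw [← Finset.sum_mul_sum, sum_weight hN, one_mul]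

theorem sum_sum_weight_diag :
    ∑ i ∈ Finset.range n, ∑ j ∈ Finset.range n,
      (if i = j then weight A n x i * weight A n x j else 0) = sumSqWeight A n x := by
  refine Finset.sum_congr rfl fun i hi => ?_
  rw [Finset.sum_ite_eq, if_pos hi, sq]

theorem sum_sum_weight_concKernel :
    ∑ i ∈ Finset.range n, ∑ j ∈ Finset.range n,
      weight A n x i * weight A n x j * concKernel (x i) (x j)
      = pairSum A n x / subsampleSize A n x ^ 2 := by
  simp only [pairSum, Finset.sum_div]
  refine Finset.sum_congr rfl fun i _ => Finset.sum_congr rfl fun j _ => ?_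
  simp only [weight_mul_weight, pairKernel]
  ring

theorem concKernel_self (y : Fin (q + 2) → ℝ) : concKernel y y = 0 := by
  simp [concKernel, ind]

/-- Without ties, the weighted discordance indicator is determined by the concordance kernel. -/
theorem weight_mul_ind_discordant (hx : NoTies A x) (i j : ℕ) :
    weight A n x i * weight A n x j * ind ((x i 0 - x j 0) * (x i 1 - x j 1) < 0)
      = weight A n x i * weight A n x j
        - 2 * (weight A n x i * weight A n x j * concKernel (x i) (x j))
        - (if i = j then weight A n x i * weight A n x j else 0) := by
  by_cases hij : i = j
  · subst hij
    rw [if_pos rfl, concKernel_self, ind_neg (by simp)]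
    ring
  · rw [if_neg hij]
    by_cases hi : coordJ (x i) ∈ A
    · by_cases hj : coordJ (x j) ∈ A
      · obtain ⟨h0, h1⟩ := hx i j hij hi hj
        rw [ind_discordant h0 h1]; ring
      · simp [weight, ind_neg hj]
    · simp [weight, ind_neg hi]

/-- Off the diagonal, concordance minus discordance is 4π - 1; on the diagonal it is 0 instead of
-1, and the correction adds the sum of squared weights. -/
theorem tauHat2_eq (hx : NoTies A x) (hN : subsampleSize A n x ≠ 0) :
    tauHat2 A n x = tauHat1 A n x + sumSqWeight A n x := by
  have h : ∀ i j, weight A n x i * weight A n x j *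
      (ind (0 < (x i 0 - x j 0) * (x i 1 - x j 1)) - ind ((x i 0 - x j 0) * (x i 1 - x j 1) < 0))
      = 4 * (weight A n x i * weight A n x j * concKernel (x i) (x j))
        - weight A n x i * weight A n x j
        + (if i = j then weight A n x i * weight A n x j else 0) := by
    intro i j
    rw [mul_sub, weight_mul_ind_discordant hx, ind_concordant]; ring
  simp only [tauHat2, h, Finset.sum_add_distrib, Finset.sum_sub_distrib]
  rw [sum_sum_weight hN, sum_sum_weight_diag, tauHat1_eq]
  simp only [← Finset.mul_sum, sum_sum_weight_concKernel]

theorem ind_discordant_eq_add (y z : Fin (q + 2) → ℝ) :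
    ind (y 0 < z 0 ∧ z 1 < y 1) + ind (z 0 < y 0 ∧ y 1 < z 1)
      = ind ((y 0 - z 0) * (y 1 - z 1) < 0) := by
  by_cases h1 : y 0 < z 0 ∧ z 1 < y 1
  · have h2 : ¬(z 0 < y 0 ∧ y 1 < z 1) := fun h => lt_asymm h.1 h1.1
    rw [ind_pos h1, ind_neg h2, ind_pos, add_zero]
    exact mul_neg_of_neg_of_pos (by linarith [h1.1]) (by linarith [h1.2])
  · by_cases h2 : z 0 < y 0 ∧ y 1 < z 1
    · rw [ind_neg h1, ind_pos h2, ind_pos, zero_add]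
      exact mul_neg_of_pos_of_neg (by linarith [h2.1]) (by linarith [h2.2])
    · rw [ind_neg h1, ind_neg h2, ind_neg, add_zero]
      intro h
      rcases mul_neg_iff.1 h with ⟨a, b⟩ | ⟨a, b⟩
      · exact h2 ⟨by linarith, by linarith⟩
      · exact h1 ⟨by linarith, by linarith⟩

/-- After symmetrization the double sum is half the total discordance, (1 - 2V/N² - s)/2; the factor
4 then doubles the diagonal correction s. -/
theorem tauHat3_eq (hx : NoTies A x) (hN : subsampleSize A n x ≠ 0) :
    tauHat3 A n x = tauHat1 A n x + 2 * sumSqWeight A n x := by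
  have h : ∀ i j, (weight A n x i * weight A n x j * ind (x i 0 < x j 0 ∧ x j 1 < x i 1)
      + weight A n x j * weight A n x i * ind (x j 0 < x i 0 ∧ x i 1 < x j 1)) / 2
      = (weight A n x i * weight A n x j
        - 2 * (weight A n x i * weight A n x j * concKernel (x i) (x j))
        - (if i = j then weight A n x i * weight A n x j else 0)) / 2 := by
    intro i j
    rw [← weight_mul_ind_discordant hx, ← ind_discordant_eq_add]; ring
  rw [tauHat3, sum_sum_symmetrize]
  simp only [h, ← Finset.sum_div, Finset.sum_sub_distrib]
  rw [sum_sum_weight hN, sum_sum_weight_diag, tauHat1_eq]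
  simp only [← Finset.mul_sum, sum_sum_weight_concKernel]
  ring

theorem pairSum_nonneg : 0 ≤ pairSum A n x :=
  Finset.sum_nonneg fun _ _ => Finset.sum_nonneg fun _ _ => pairKernel_nonneg _ _ _

theorem pairSum_le : pairSum A n x ≤ subsampleSize A n x ^ 2 := by
  rw [sq, subsampleSize, Finset.sum_mul_sum]
  refine Finset.sum_le_sum fun i _ => Finset.sum_le_sum fun j _ => ?_
  exact mul_le_of_le_one_right (mul_nonneg (ind_nonneg _) (ind_nonneg _)) (concKernel_le_one _ _)

/-- Without ties, all four estimators agree up to the inverse subsample size. -/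
theorem abs_sub_tauHat1_le {T : Set (Fin q → ℝ) → ℕ → (ℕ → Fin (q + 2) → ℝ) → ℝ}
    (hT : T ∈ ({tauHat, tauHat1, tauHat2, tauHat3} :
      Set (Set (Fin q → ℝ) → ℕ → (ℕ → Fin (q + 2) → ℝ) → ℝ)))
    (hx : NoTies A x) (hN : 2 ≤ subsampleSize A n x) :
    |T A n x - tauHat1 A n x| ≤ 8 / subsampleSize A n x := by
  have hN0 : 0 < subsampleSize A n x := by linarith
  have hs := sumSqWeight_eq hN0.ne'
  have hs0 : 0 < sumSqWeight A n x := by rw [hs]; positivity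
  have h8 : 8 / subsampleSize A n x = 8 * sumSqWeight A n x := by rw [hs]; rfl
  rw [h8]
  rcases hT with rfl | rfl | rfl | rfl
  · have hs2 : sumSqWeight A n x ≤ 1 / 2 := by
      rw [hs, one_div]; exact inv_anti₀ two_pos hN
    have h1 : tauHat A n x - tauHat1 A n x =
        sumSqWeight A n x * (1 + tauHat1 A n x) / (1 - sumSqWeight A n x) := by
      have : 1 - sumSqWeight A n x ≠ 0 := by linarith
      rw [tauHat]; field_simp; ring
    have h2 : 0 ≤ 1 + tauHat1 A n x := by
      rw [tauHat1_eq]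
      have := div_nonneg (pairSum_nonneg (A := A) (n := n) (x := x))
        (sq_nonneg (subsampleSize A n x))
      linarith
    have h3 : 1 + tauHat1 A n x ≤ 4 := by
      rw [tauHat1_eq]
      have : pairSum A n x / subsampleSize A n x ^ 2 ≤ 1 := div_le_one_of_le₀ pairSum_le (sq_nonneg _)
      linarith
    rw [h1, abs_of_nonneg (div_nonneg (mul_nonneg hs0.le h2) (by linarith)),
      div_le_iff₀ (by linarith)]
    nlinarith
  · rw [sub_self, abs_zero]; positivity
  · rw [tauHat2_eq hx hN0.ne', add_sub_cancel_left, abs_of_pos hs0]; linarith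
  · rw [tauHat3_eq hx hN0.ne', add_sub_cancel_left,
      abs_of_pos (by positivity)]
    linarith

/-- The second-order remainder of the quotient `v / u²` around `(D, p)`. -/
theorem abs_quotient_linearization_le {p : ℝ} (hp : 0 < p) (D l r b : ℝ) (hb : |b| ≤ p / 2) :
    |(D + 2 * l + r) / (p + b) ^ 2 - D / p ^ 2 - (2 * l / p ^ 2 - 2 * D * b / p ^ 3)|
      ≤ 4 / p ^ 2 * (1 + 5 / (2 * p) + 6 * |D| / p ^ 2) * (|r| + l ^ 2 + b ^ 2) := by
  obtain ⟨hb1, hb2⟩ := abs_le.1 hb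
  have hpb : 0 < p + b := by linarith
  -- Over the common denominator the first-order terms cancel, leaving r and products of two of the
  -- small quantities. The bound on b gives p + b ≥ p/2 and 2p + b ≤ 5p/2, the sources of the
  -- constants 4 and 5.
  have hid : (D + 2 * l + r) / (p + b) ^ 2 - D / p ^ 2 - (2 * l / p ^ 2 - 2 * D * b / p ^ 3)
      = ((p + b) ^ 2)⁻¹ *
        (r - (2 * l - 2 * D * b / p) * (b * (2 * p + b)) / p ^ 2 - D * b ^ 2 / p ^ 2) := by
    field_simp; ring
  have hc : ((p + b) ^ 2)⁻¹ ≤ 4 / p ^ 2 := by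
    rw [inv_le_comm₀ (by positivity) (by positivity), inv_div]
    nlinarith
  have h1 : |(2 * l - 2 * D * b / p) * (b * (2 * p + b)) / p ^ 2|
      ≤ 5 / (2 * p) * (l ^ 2 + b ^ 2) + 5 * |D| / p ^ 2 * b ^ 2 := by
    have e1 : |2 * l - 2 * D * b / p| ≤ 2 * |l| + 2 * |D| * |b| / p := by
      refine (abs_sub _ _).trans_eq ?_
      rw [abs_div, abs_mul, abs_mul, abs_mul, abs_of_pos hp, abs_two]
    have e2 : |b * (2 * p + b)| ≤ |b| * (5 * p / 2) := by
      rw [abs_mul]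
      refine mul_le_mul_of_nonneg_left ?_ (abs_nonneg _)
      rw [abs_of_pos (by linarith)]; linarith
    rw [abs_div, abs_mul, abs_of_pos (by positivity : 0 < p ^ 2)]
    calc _ ≤ (2 * |l| + 2 * |D| * |b| / p) * (|b| * (5 * p / 2)) / p ^ 2 := by gcongr
      _ = 5 / (2 * p) * (2 * |l| * |b|) + 5 * |D| / p ^ 2 * |b| ^ 2 := by field_simp
      _ ≤ 5 / (2 * p) * (l ^ 2 + b ^ 2) + 5 * |D| / p ^ 2 * b ^ 2 := by
        rw [sq_abs]
        gcongr
        rw [← sq_abs l, ← sq_abs b]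
        exact two_mul_le_add_sq _ _
  have h2 : |D * b ^ 2 / p ^ 2| = |D| / p ^ 2 * b ^ 2 := by
    rw [abs_div, abs_mul, abs_of_nonneg (sq_nonneg b), abs_of_pos (by positivity : 0 < p ^ 2)]
    ring
  rw [hid, abs_mul, abs_of_pos (by positivity : 0 < ((p + b) ^ 2)⁻¹), mul_assoc (4 / p ^ 2)]
  refine mul_le_mul hc ?_ (abs_nonneg _) (by positivity)
  calc _ ≤ |r| + |(2 * l - 2 * D * b / p) * (b * (2 * p + b)) / p ^ 2| + |D * b ^ 2 / p ^ 2| :=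
        (abs_sub _ _).trans (add_le_add_left (abs_sub _ _) _)
    _ ≤ |r| + (5 / (2 * p) * (l ^ 2 + b ^ 2) + 5 * |D| / p ^ 2 * b ^ 2) + |D| / p ^ 2 * b ^ 2 := by
        rw [h2]; gcongr
    _ = |r| + 5 / (2 * p) * (l ^ 2 + b ^ 2) + 6 * |D| / p ^ 2 * b ^ 2 := by ring
    _ ≤ |r| + 5 / (2 * p) * (|r| + l ^ 2 + b ^ 2) + 6 * |D| / p ^ 2 * (|r| + l ^ 2 + b ^ 2) +
        (l ^ 2 + b ^ 2) := by
        have := abs_nonneg r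
        have e1 : 5 / (2 * p) * (l ^ 2 + b ^ 2) ≤ 5 / (2 * p) * (|r| + l ^ 2 + b ^ 2) := by
          gcongr; linarith
        have e2 : 6 * |D| / p ^ 2 * b ^ 2 ≤ 6 * |D| / p ^ 2 * (|r| + l ^ 2 + b ^ 2) := by
          gcongr; nlinarith
        nlinarith [sq_nonneg l, sq_nonneg b]
    _ = _ := by ring

end Sample

/-! ### Hoeffding decomposition and negligibility of the remainder. -/

noncomputable section Expansion

variable {q : ℕ} {P : Measure (Fin (q + 2) → ℝ)} {A : Set (Fin q → ℝ)}

/-- The first-order projection `x ↦ ∫ 𝟏{x_J ∈ A, y_J ∈ A} π(y, x) ℙ(dy)` of the pair kernel. -/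
def projKernel (P : Measure (Fin (q + 2) → ℝ)) (A : Set (Fin q → ℝ)) (x : Fin (q + 2) → ℝ) : ℝ :=
  prob P A * (ind (coordJ x ∈ A) * condMean P A x)

/-- The degenerate part of the pair kernel in its Hoeffding decomposition. -/
def degenKernel (P : Measure (Fin (q + 2) → ℝ)) (A : Set (Fin q → ℝ))
    (x y : Fin (q + 2) → ℝ) : ℝ :=
  pairKernel A x y - projKernel P A x - projKernel P A y + concD P A

theorem measurable_projKernel (hA : MeasurableSet A) : Measurable (projKernel P A) :=
  ((measurable_ind_coordJ hA).mul measurable_condMean).const_mul _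

theorem measurable_degenKernel (hA : MeasurableSet A) :
    Measurable (Function.uncurry (degenKernel P A)) :=
  (((measurable_pairKernel hA).sub ((measurable_projKernel hA).comp measurable_fst)).sub
    ((measurable_projKernel hA).comp measurable_snd)).add_const _

theorem degenKernel_comm (x y : Fin (q + 2) → ℝ) :
    degenKernel P A x y = degenKernel P A y x := by
  simp only [degenKernel, pairKernel_comm A x y]; ring

theorem abs_projKernel_le_one [IsProbabilityMeasure P] (x : Fin (q + 2) → ℝ) :
    |projKernel P A x| ≤ 1 := by
  have h : 0 ≤ prob P A := measureReal_nonneg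
  rw [projKernel, abs_mul, abs_of_nonneg h]
  exact mul_le_one₀ measureReal_le_one (abs_nonneg _) (abs_ind_mul_le _ (abs_condMean_le_one x))

theorem abs_concD_le_one [IsProbabilityMeasure P] : |concD P A| ≤ 1 := by
  have h : 0 ≤ concD P A := measureReal_nonneg
  rw [abs_of_nonneg h]
  exact measureReal_le_one

theorem abs_degenKernel_le [IsProbabilityMeasure P] (x y : Fin (q + 2) → ℝ) :
    |degenKernel P A x y| ≤ 4 := by
  have h1 := abs_le.1 (abs_projKernel_le_one (P := P) (A := A) x)
  have h2 := abs_le.1 (abs_projKernel_le_one (P := P) (A := A) y)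
  have h3 := abs_le.1 (abs_concD_le_one (P := P) (A := A))
  have h4 := pairKernel_nonneg A x y
  have h5 := pairKernel_le_one A x y
  rw [degenKernel, abs_le]
  constructor <;> linarith [h1.1, h1.2, h2.1, h2.2, h3.1, h3.2]

theorem integral_projKernel [IsProbabilityMeasure P] (hA : MeasurableSet A)
    (hp : 0 < prob P A) : ∫ x, projKernel P A x ∂P = concD P A := by
  simp only [projKernel]
  rw [integral_const_mul, integral_ind_mul_condMean hA hp, mul_div_cancel₀ _ hp.ne']

/-- Integrating out x turns the pair kernel into its projection at y and the projection at x into D,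
so the four terms cancel in pairs, for every y. -/
theorem integral_degenKernel [IsProbabilityMeasure P] (hA : MeasurableSet A)
    (hp : 0 < prob P A) (y : Fin (q + 2) → ℝ) : ∫ x, degenKernel P A x y ∂P = 0 := by
  have i1 : Integrable (fun x => pairKernel A x y) P :=
    integrable_of_abs_le_one ((measurable_pairKernel hA).comp measurable_prodMk_right) fun x => by
      rw [abs_of_nonneg (pairKernel_nonneg _ _ _)]; exact pairKernel_le_one _ _ _
  have i2 : Integrable (projKernel P A) P :=
    integrable_of_abs_le_one (measurable_projKernel hA) abs_projKernel_le_one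
  have h : ∀ x, degenKernel P A x y
      = (pairKernel A x y - projKernel P A x) + (concD P A - projKernel P A y) := fun x => by
    rw [degenKernel]; ring
  simp only [h]
  refine (integral_add (i1.sub i2) (integrable_const _)).trans ?_
  rw [integral_sub' i1 i2, integral_pairKernel hA hp, integral_projKernel hA hp]
  simp only [integral_const, probReal_univ, one_smul, projKernel]
  ring

/-- The Hoeffding decomposition of the sum over all pairs. -/
theorem pairSum_eq (P : Measure (Fin (q + 2) → ℝ)) (A : Set (Fin q → ℝ)) (n : ℕ)
    (x : ℕ → Fin (q + 2) → ℝ) :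
    pairSum A n x = n ^ 2 * concD P A
      + 2 * n * ∑ i ∈ Finset.range n, (projKernel P A (x i) - concD P A)
      + ∑ i ∈ Finset.range n, ∑ j ∈ Finset.range n, degenKernel P A (x i) (x j) := by
  simp only [degenKernel, pairSum, Finset.sum_add_distrib, Finset.sum_sub_distrib,
    Finset.sum_const, Finset.card_range, nsmul_eq_mul, ← Finset.mul_sum]
  ring

/-- The quantity that controls the error of the linear expansion of the estimators. -/
def expansionError (P : Measure (Fin (q + 2) → ℝ)) (A : Set (Fin q → ℝ)) (n : ℕ)
    (x : ℕ → Fin (q + 2) → ℝ) : ℝ :=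
  (∑ i ∈ Finset.range n, ∑ j ∈ Finset.range n, degenKernel P A (x i) (x j)) ^ 2 / n ^ 3
    + (∑ i ∈ Finset.range n, (projKernel P A (x i) - concD P A)) ^ 2 / n ^ 2
    + (∑ i ∈ Finset.range n, (ind (coordJ (x i) ∈ A) - prob P A)) ^ 2 / n ^ 2 + 1 / n

theorem expansionError_nonneg (n : ℕ) (x : ℕ → Fin (q + 2) → ℝ) : 0 ≤ expansionError P A n x := by
  unfold expansionError; positivity

theorem subsampleSize_eq (P : Measure (Fin (q + 2) → ℝ)) (A : Set (Fin q → ℝ)) (n : ℕ)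
    (x : ℕ → Fin (q + 2) → ℝ) : subsampleSize A n x =
      n * prob P A + ∑ i ∈ Finset.range n, (ind (coordJ (x i) ∈ A) - prob P A) := by
  simp [subsampleSize, Finset.sum_sub_distrib]

theorem sum_influence (hp : 0 < prob P A) (n : ℕ) (x : ℕ → Fin (q + 2) → ℝ) :
    ∑ i ∈ Finset.range n, influence P A (x i) =
      8 * ((∑ i ∈ Finset.range n, (projKernel P A (x i) - concD P A)) / prob P A ^ 2
        - concD P A * (∑ i ∈ Finset.range n, (ind (coordJ (x i) ∈ A) - prob P A))
          / prob P A ^ 3) := by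
  rw [Finset.mul_sum, Finset.sum_div, Finset.sum_div, ← Finset.sum_sub_distrib, Finset.mul_sum]
  refine Finset.sum_congr rfl fun i _ => ?_
  simp only [influence, projKernel]
  field_simp
  ring

/-- The linear expansion of the estimators on samples without ties. -/
theorem exists_abs_expansion_le {T : Set (Fin q → ℝ) → ℕ → (ℕ → Fin (q + 2) → ℝ) → ℝ}
    (hT : T ∈ ({tauHat, tauHat1, tauHat2, tauHat3} :
      Set (Set (Fin q → ℝ) → ℕ → (ℕ → Fin (q + 2) → ℝ) → ℝ)))
    (hp : 0 < prob P A) :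
    ∃ C, 0 ≤ C ∧ ∀ n : ℕ, 4 / prob P A ≤ n → ∀ x, NoTies A x →
      |∑ i ∈ Finset.range n, (ind (coordJ (x i) ∈ A) - prob P A)| ≤ n * prob P A / 2 →
      |√(n : ℝ) * (T A n x - (4 * concD P A / prob P A ^ 2 - 1))
        - (√(n : ℝ))⁻¹ * ∑ i ∈ Finset.range n, influence P A (x i)|
        ≤ C * √(n : ℝ) * expansionError P A n x := by
  obtain ⟨K, hK⟩ : ∃ K, K = 4 / prob P A ^ 2 *
    (1 + 5 / (2 * prob P A) + 6 * |concD P A| / prob P A ^ 2) := ⟨_, rfl⟩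
  have hK0 : 0 ≤ K := by rw [hK]; positivity
  -- The term 4K is the factor 4 in τ̂⁽¹⁾ times the linearization constant. On the event considered
  -- N ≥ np/2, so 8/N ≤ 16/(pn); the condition n ≥ 4/p then ensures N ≥ 2.
  refine ⟨4 * K + 16 / prob P A, by positivity, fun n hn x hx hB => ?_⟩
  rw [sum_influence hp]
  have hlin := fun l r b hb => abs_quotient_linearization_le hp (concD P A) l r b hb
  rw [← hK] at hlin
  have hsub := subsampleSize_eq P A n x
  have hpair := pairSum_eq P A n x
  have hT1 := fun h => abs_sub_tauHat1_le (n := n) hT hx h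
  have ht1 := tauHat1_eq A n x
  unfold expansionError
  generalize ∑ i ∈ Finset.range n, (ind (coordJ (x i) ∈ A) - prob P A) = B at *
  generalize ∑ i ∈ Finset.range n, (projKernel P A (x i) - concD P A) = L at *
  generalize ∑ i ∈ Finset.range n, ∑ j ∈ Finset.range n, degenKernel P A (x i) (x j) = R at *
  generalize pairSum A n x = W at *
  generalize subsampleSize A n x = N at *
  generalize tauHat1 A n x = t1 at *
  generalize T A n x = t at *
  generalize concD P A = D at *
  generalize prob P A = p at *
  generalize (n : ℝ) = ν at *
  have hν0 : 0 < ν := lt_of_lt_of_le (div_pos (by norm_num) hp) hn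
  have hνp : 4 ≤ ν * p := by rwa [div_le_iff₀ hp] at hn
  obtain ⟨hB1, hB2⟩ := abs_le.1 hB
  have hNlow : ν * p / 2 ≤ N := by rw [hsub]; linarith
  have hN2 : 2 ≤ N := by linarith
  have hN0 : 0 < N := by linarith
  have hb : |B / ν| ≤ p / 2 := by
    rw [abs_div, abs_of_pos hν0, div_le_iff₀ hν0]; linarith
  have key := hlin (L / ν) (R / ν ^ 2) (B / ν) hb
  have hq : (D + 2 * (L / ν) + R / ν ^ 2) / (p + B / ν) ^ 2 = W / N ^ 2 := by
    have : p + B / ν = N / ν := by rw [hsub]; field_simp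
    rw [this, hpair]; field_simp
  rw [hq] at key
  have h8 : 8 / N ≤ 16 / p * (1 / ν) := by
    rw [div_mul_div_comm, div_le_div_iff₀ hN0 (by positivity)]
    linarith
  -- From |R| ν ≤ R² + ν²: the first-order quantity |R| is traded for R², so that second moments
  -- suffice.
  have hr : |R / ν ^ 2| ≤ R ^ 2 / ν ^ 3 + 1 / ν := by
    rw [abs_div, abs_of_pos (by positivity : 0 < ν ^ 2)]
    have : R ^ 2 / ν ^ 3 + 1 / ν - |R| / ν ^ 2 = (|R| ^ 2 + ν ^ 2 - |R| * ν) / ν ^ 3 := by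
      rw [sq_abs]; field_simp
    have h0 : 0 ≤ (|R| ^ 2 + ν ^ 2 - |R| * ν) / ν ^ 3 := by
      refine div_nonneg ?_ (by positivity)
      nlinarith [sq_nonneg (|R| - ν), abs_nonneg R]
    linarith
  have hs : (√ν)⁻¹ = √ν * (1 / ν) := by
    rw [mul_one_div, Real.sqrt_div_self', one_div]
  have hfac : √ν * (t - (4 * D / p ^ 2 - 1)) - (√ν)⁻¹ * (8 * (L / p ^ 2 - D * B / p ^ 3))
      = √ν * ((t - t1) + 4 * (W / N ^ 2 - D / p ^ 2
        - (2 * (L / ν) / p ^ 2 - 2 * D * (B / ν) / p ^ 3))) := by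
    rw [hs, ht1]; ring
  rw [hfac, abs_mul, abs_of_nonneg (Real.sqrt_nonneg ν), mul_comm _ √ν, mul_assoc √ν]
  refine mul_le_mul_of_nonneg_left ?_ (Real.sqrt_nonneg ν)
  calc _ ≤ |t - t1| + 4 * |W / N ^ 2 - D / p ^ 2
        - (2 * (L / ν) / p ^ 2 - 2 * D * (B / ν) / p ^ 3)| := by
        refine (abs_add_le _ _).trans_eq ?_
        rw [abs_mul, abs_of_pos (by norm_num : (0 : ℝ) < 4)]
    _ ≤ 16 / p * (1 / ν) + 4 * (K * (|R / ν ^ 2| + (L / ν) ^ 2 + (B / ν) ^ 2)) := by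
        gcongr; exact (hT1 hN2).trans h8
    _ ≤ 16 / p * (1 / ν) + 4 * (K * (R ^ 2 / ν ^ 3 + 1 / ν + (L / ν) ^ 2 + (B / ν) ^ 2)) := by
        gcongr
    _ ≤ 16 / p * (R ^ 2 / ν ^ 3 + L ^ 2 / ν ^ 2 + B ^ 2 / ν ^ 2 + 1 / ν)
        + 4 * (K * (R ^ 2 / ν ^ 3 + 1 / ν + (L / ν) ^ 2 + (B / ν) ^ 2)) := by
        gcongr
        have : 0 ≤ R ^ 2 / ν ^ 3 + L ^ 2 / ν ^ 2 + B ^ 2 / ν ^ 2 := by positivity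
        linarith
    _ = _ := by rw [div_pow, div_pow]; ring

variable {Ω : Type*} [MeasurableSpace Ω] {μ : Measure Ω} [IsProbabilityMeasure μ]
  {X : ℕ → Ω → Fin (q + 2) → ℝ}

/-- The error of the linear expansion is integrable, with mean of order `1 / n`. -/
theorem integral_expansionError_le (hindep : iIndepFun X μ) (hlaw : ∀ i, HasLaw (X i) P μ)
    (hA : MeasurableSet A) (hp : 0 < prob P A) {n : ℕ} (hn : 0 < n) :
    Integrable (fun ω => expansionError P A n fun i => X i ω) μ ∧
      ∫ ω, expansionError P A n (fun i => X i ω) ∂μ ≤ 54 / n := by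
  have hP : IsProbabilityMeasure P := (hlaw 0).isProbabilityMeasure_iff.1 inferInstance
  have hX : ∀ i, AEMeasurable (X i) μ := fun i => (hlaw i).aemeasurable
  have bR : ∀ x y, |degenKernel P A x y| ≤ 4 := abs_degenKernel_le
  have bL : ∀ x, |projKernel P A x - concD P A| ≤ 2 := fun x => by
    have h1 := abs_projKernel_le_one (P := P) (A := A) x
    have h2 := abs_concD_le_one (P := P) (A := A)
    exact (abs_sub _ _).trans (by linarith)
  have hp1 : prob P A ≤ 1 := measureReal_le_one
  have bB : ∀ x : Fin (q + 2) → ℝ, |ind (coordJ x ∈ A) - prob P A| ≤ 1 := fun x => by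
    have h1 := ind_nonneg (coordJ x ∈ A)
    have h2 := ind_le_one (coordJ x ∈ A)
    rw [abs_le]; constructor <;> linarith
  have mL : Measurable fun x => projKernel P A x - concD P A :=
    (measurable_projKernel hA).sub_const _
  have mB : Measurable fun x : Fin (q + 2) → ℝ => ind (coordJ x ∈ A) - prob P A :=
    (measurable_ind_coordJ hA).sub_const _
  have mR := measurable_degenKernel (P := P) hA
  have zL : ∫ x, (projKernel P A x - concD P A) ∂P = 0 := by
    rw [integral_sub (integrable_of_abs_le_one (measurable_projKernel hA) abs_projKernel_le_one)
      (integrable_const _), integral_projKernel hA hp]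
    simp
  have zB : ∫ x, (ind (coordJ x ∈ A) - prob P A) ∂P = 0 := by
    rw [integral_sub (integrable_of_abs_le_one (measurable_ind_coordJ hA) fun x => by
      rw [abs_of_nonneg (ind_nonneg _)]; exact ind_le_one _)
      (integrable_const _), integral_ind _ (measurableSet_coordJ hA)]
    simp [prob]
  have eR := integral_sq_sum_kernel_le hindep hlaw mR bR degenKernel_comm
    (integral_degenKernel hA hp) n
  have eL := integral_sq_sum_comp_le hindep hlaw mL bL zL n
  have eB := integral_sq_sum_comp_le hindep hlaw mB bB zB n
  have iR : Integrable (fun ω => (∑ i ∈ Finset.range n, ∑ j ∈ Finset.range n,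
      degenKernel P A (X i ω) (X j ω)) ^ 2) μ := by
    refine (memLp_finsetSum _ fun i _ => memLp_finsetSum _ fun j _ => ?_).integrable_sq
    exact MemLp.of_bound (mR.comp_aemeasurable ((hX i).prodMk (hX j))).aestronglyMeasurable 4
      (ae_of_all _ fun ω => bR _ _)
  have iL : Integrable (fun ω => (∑ i ∈ Finset.range n,
      (projKernel P A (X i ω) - concD P A)) ^ 2) μ := by
    refine (memLp_finsetSum _ fun i _ => ?_).integrable_sq
    exact MemLp.of_bound (mL.comp_aemeasurable (hX i)).aestronglyMeasurable 2
      (ae_of_all _ fun ω => bL _)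
  have iB : Integrable (fun ω => (∑ i ∈ Finset.range n,
      (ind (coordJ (X i ω) ∈ A) - prob P A)) ^ 2) μ := by
    refine (memLp_finsetSum _ fun i _ => ?_).integrable_sq
    exact MemLp.of_bound (mB.comp_aemeasurable (hX i)).aestronglyMeasurable 1
      (ae_of_all _ fun ω => bB _)
  have j1 := Integrable.fun_add (iR.div_const ((n : ℝ) ^ 3)) (iL.div_const ((n : ℝ) ^ 2))
  have j2 := Integrable.fun_add j1 (iB.div_const ((n : ℝ) ^ 2))
  have j3 := Integrable.fun_add j2 (integrable_const (1 / (n : ℝ)))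
  refine ⟨j3, ?_⟩
  unfold expansionError
  rw [integral_add j2 (integrable_const _), integral_add j1 (iB.div_const _),
    integral_add (iR.div_const _) (iL.div_const _), integral_div, integral_div, integral_div]
  have hν : (0 : ℝ) < n := Nat.cast_pos.2 hn
  -- The uniform bounds 4, 2 and 1 on the three summands give 48 + 4 + 1, and the explicit 1/n
  -- brings the total to 54.
  calc _ ≤ 3 * 4 ^ 2 * (n : ℝ) ^ 2 / (n : ℝ) ^ 3 + n * 2 ^ 2 / (n : ℝ) ^ 2
        + n * 1 ^ 2 / (n : ℝ) ^ 2 + 1 / n := by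
        gcongr
        simp
    _ = 54 / n := by field_simp; norm_num

/-- Samples of an i.i.d. sequence almost surely have no ties. -/
theorem ae_noTies (hindep : iIndepFun X μ) (hlaw : ∀ i, HasLaw (X i) P μ)
    (hA : MeasurableSet A) (hpos : 0 < P {x | coordJ x ∈ A})
    (hc0 : Continuous (cdf ((condLaw P A).map fun x => x 0)))
    (hc1 : Continuous (cdf ((condLaw P A).map fun x => x 1))) :
    ∀ᵐ ω ∂μ, NoTies A fun i => X i ω := by
  have hP : IsProbabilityMeasure P := (hlaw 0).isProbabilityMeasure_iff.1 inferInstance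
  have hX : ∀ i, AEMeasurable (X i) μ := fun i => (hlaw i).aemeasurable
  simp only [NoTies, ae_all_iff]
  intro i j hij
  have hmap := (indepFun_iff_map_prod_eq_prod_map_map (hX i) (hX j)).1 (hindep.indepFun hij)
  rw [(hlaw i).map_eq, (hlaw j).map_eq] at hmap
  have h := (ae_prod_ne hA hpos hc0).and (ae_prod_ne hA hpos hc1)
  rw [← hmap] at h
  filter_upwards [ae_of_ae_map ((hX i).prodMk (hX j)) h] with ω hω hi hj
  exact ⟨hω.1 hi hj, hω.2 hi hj⟩

/-- The difference between a rescaled estimator and its linear part tends to zero in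
probability. -/
theorem tendsto_measure_expansion {T : Set (Fin q → ℝ) → ℕ → (ℕ → Fin (q + 2) → ℝ) → ℝ}
    (hT : T ∈ ({tauHat, tauHat1, tauHat2, tauHat3} :
      Set (Set (Fin q → ℝ) → ℕ → (ℕ → Fin (q + 2) → ℝ) → ℝ)))
    (hindep : iIndepFun X μ) (hlaw : ∀ i, HasLaw (X i) P μ)
    (hA : MeasurableSet A) (hpos : 0 < P {x | coordJ x ∈ A})
    (hc0 : Continuous (cdf ((condLaw P A).map fun x => x 0)))
    (hc1 : Continuous (cdf ((condLaw P A).map fun x => x 1))) {ε : ℝ} (hε : 0 < ε) :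
    Tendsto (fun n : ℕ => μ.real {ω | ε ≤ |√(n : ℝ) * (T A n (fun i => X i ω) - tau P A)
      - (√(n : ℝ))⁻¹ * ∑ i ∈ Finset.range n, influence P A (X i ω)|}) atTop (nhds 0) := by
  have hP : IsProbabilityMeasure P := (hlaw 0).isProbabilityMeasure_iff.1 inferInstance
  have hp := prob_pos hpos
  obtain ⟨C, hC, hbound⟩ := exists_abs_expansion_le hT hp
  rw [tau_eq hA hpos hc0 hc1]
  -- Up to a null set, a deviation of at least ε forces this coefficient times `expansionError` to
  -- be at least 1. If |B| ≤ np/2, the linear expansion gives it through the first summand;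
  -- otherwise B²/n² > p²/4 gives it through the second. Markov's inequality then bounds the
  -- probability by this O(n^(-1/2)) expression.
  have hlim : Tendsto (fun n : ℕ => (C / ε * √(n : ℝ) + 4 / prob P A ^ 2) * (54 / n))
      atTop (nhds 0) := by
    have h1 : Tendsto (fun n : ℕ => (n : ℝ)⁻¹) atTop (nhds 0) :=
      tendsto_inv_atTop_zero.comp tendsto_natCast_atTop_atTop
    have h2 : Tendsto (fun n : ℕ => (√(n : ℝ))⁻¹) atTop (nhds 0) :=
      tendsto_inv_atTop_zero.comp (Real.tendsto_sqrt_atTop.comp tendsto_natCast_atTop_atTop)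
    have h3 := (h2.const_mul (C / ε * 54)).add (h1.const_mul (4 / prob P A ^ 2 * 54))
    rw [mul_zero, mul_zero, add_zero] at h3
    refine h3.congr fun n => ?_
    have : (√(n : ℝ))⁻¹ = √(n : ℝ) * (n : ℝ)⁻¹ := by
      rw [← div_eq_mul_inv, Real.sqrt_div_self', one_div]
    rw [this]; ring
  refine squeeze_zero' (Eventually.of_forall fun n => measureReal_nonneg) ?_ hlim
  filter_upwards [eventually_gt_atTop 0,
    tendsto_natCast_atTop_atTop.eventually_ge_atTop (4 / prob P A)] with n hn hn4
  obtain ⟨hint, hle⟩ := integral_expansionError_le hindep hlaw hA hp hn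
  have hν : (0 : ℝ) < n := Nat.cast_pos.2 hn
  have hcoef : 0 ≤ C / ε * √(n : ℝ) + 4 / prob P A ^ 2 := by positivity
  have hmarkov := mul_meas_ge_le_integral_of_nonneg (μ := μ)
    (ae_of_all _ fun ω => mul_nonneg hcoef (expansionError_nonneg (P := P) (A := A) n
      fun i => X i ω)) (hint.const_mul _) 1
  rw [one_mul, integral_const_mul] at hmarkov
  refine le_trans ?_ (hmarkov.trans (mul_le_mul_of_nonneg_left hle hcoef))
  refine ENNReal.toReal_mono (measure_ne_top _ _) (measure_mono_ae ?_)
  filter_upwards [ae_noTies hindep hlaw hA hpos hc0 hc1] with ω hω hmem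
  have hmem' : ε ≤ |√(n : ℝ) * (T A n (fun i => X i ω) - (4 * concD P A / prob P A ^ 2 - 1))
      - (√(n : ℝ))⁻¹ * ∑ i ∈ Finset.range n, influence P A (X i ω)| := hmem
  change 1 ≤ (C / ε * √(n : ℝ) + 4 / prob P A ^ 2) * expansionError P A n fun i => X i ω
  have he0 := expansionError_nonneg (P := P) (A := A) n fun i => X i ω
  by_cases hB : |∑ i ∈ Finset.range n, (ind (coordJ (X i ω) ∈ A) - prob P A)| ≤ n * prob P A / 2
  · have h1 := hmem'.trans (hbound n hn4 (fun i => X i ω) hω hB)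
    have h2 : 1 ≤ C / ε * √(n : ℝ) * expansionError P A n fun i => X i ω := by
      rw [div_mul_eq_mul_div, div_mul_eq_mul_div, le_div_iff₀ hε, one_mul]
      exact h1
    have h3 : 0 ≤ 4 / prob P A ^ 2 * expansionError P A n fun i => X i ω := by positivity
    linarith
  · have h1 : (∑ i ∈ Finset.range n, (ind (coordJ (X i ω) ∈ A) - prob P A)) ^ 2 / (n : ℝ) ^ 2
        ≤ expansionError P A n fun i => X i ω := by
      have e1 : 0 ≤ (∑ i ∈ Finset.range n, ∑ j ∈ Finset.range n,
        degenKernel P A (X i ω) (X j ω)) ^ 2 / (n : ℝ) ^ 3 := by positivity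
      have e2 : 0 ≤ (∑ i ∈ Finset.range n, (projKernel P A (X i ω) - concD P A)) ^ 2
        / (n : ℝ) ^ 2 := by positivity
      have e3 : 0 ≤ 1 / (n : ℝ) := by positivity
      unfold expansionError
      linarith
    have h2 : (n * prob P A / 2) ^ 2 ≤
        (∑ i ∈ Finset.range n, (ind (coordJ (X i ω) ∈ A) - prob P A)) ^ 2 := by
      rw [← sq_abs (∑ i ∈ Finset.range n, _)]
      exact pow_le_pow_left₀ (by positivity) (not_le.1 hB).le 2
    have h3 : 1 ≤ 4 / prob P A ^ 2 * expansionError P A n fun i => X i ω := by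
      calc (1 : ℝ) = 4 / prob P A ^ 2 * ((n * prob P A / 2) ^ 2 / (n : ℝ) ^ 2) := by
            field_simp; norm_num
        _ ≤ _ := mul_le_mul_of_nonneg_left ((div_le_div_of_nonneg_right h2 (by positivity)).trans
            h1) (by positivity)
    have h4 : 0 ≤ C / ε * √(n : ℝ) * expansionError P A n fun i => X i ω := by positivity
    linarith

end Expansion

/-! ### Measurability, coordinatewise convergence and the disjoint case. -/

noncomputable section Limit

variable {q : ℕ} {A : Set (Fin q → ℝ)}

theorem measurable_subsampleSize (hA : MeasurableSet A) (n : ℕ) :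
    Measurable fun x : ℕ → Fin (q + 2) → ℝ => subsampleSize A n x :=
  Finset.measurable_sum _ fun i _ => (measurable_ind_coordJ hA).comp (measurable_pi_apply i)

theorem measurable_weight (hA : MeasurableSet A) (n i : ℕ) :
    Measurable fun x : ℕ → Fin (q + 2) → ℝ => weight A n x i :=
  ((measurable_ind_coordJ hA).comp (measurable_pi_apply i)).div (measurable_subsampleSize hA n)

theorem measurable_pair_apply (i j : ℕ) :
    Measurable fun x : ℕ → Fin (q + 2) → ℝ => (x i, x j) :=
  (measurable_pi_apply i).prodMk (measurable_pi_apply j)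

theorem measurable_tauHat1 (hA : MeasurableSet A) (n : ℕ) :
    Measurable fun x : ℕ → Fin (q + 2) → ℝ => tauHat1 A n x := by
  refine ((Finset.measurable_sum _ fun i _ => Finset.measurable_sum _ fun j _ =>
    ((measurable_weight hA n i).mul (measurable_weight hA n j)).mul
      (measurable_ind ?_)).const_mul 4).sub_const 1
  exact measurable_pair_apply i j measurableSet_lt_and_lt

theorem measurable_estimator {T : Set (Fin q → ℝ) → ℕ → (ℕ → Fin (q + 2) → ℝ) → ℝ}
    (hT : T ∈ ({tauHat, tauHat1, tauHat2, tauHat3} :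
      Set (Set (Fin q → ℝ) → ℕ → (ℕ → Fin (q + 2) → ℝ) → ℝ)))
    (hA : MeasurableSet A) (n : ℕ) : Measurable fun x => T A n x := by
  rcases hT with rfl | rfl | rfl | rfl
  · have hs : Measurable fun x : ℕ → Fin (q + 2) → ℝ => sumSqWeight A n x :=
      Finset.measurable_sum _ fun i _ => (measurable_weight hA n i).pow_const 2
    exact ((measurable_tauHat1 hA n).div (hs.const_sub 1)).add (hs.div (hs.const_sub 1))
  · exact measurable_tauHat1 hA n
  · refine Finset.measurable_sum _ fun i _ => Finset.measurable_sum _ fun j _ =>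
      ((measurable_weight hA n i).mul (measurable_weight hA n j)).mul
        ((measurable_ind ?_).sub (measurable_ind ?_))
    · exact measurableSet_lt measurable_const (by fun_prop)
    · exact measurableSet_lt (by fun_prop) measurable_const
  · refine ((Finset.measurable_sum _ fun i _ => Finset.measurable_sum _ fun j _ =>
      ((measurable_weight hA n i).mul (measurable_weight hA n j)).mul
        (measurable_ind ?_)).const_mul 4).const_sub 1
    exact (measurable_pair_apply i j measurableSet_setOf_lt).inter
      (measurable_pair_apply j i measurableSet_setOf_lt)

/-- Convergence to zero in probability of a random vector follows from that of its coordinates. -/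
theorem tendstoInMeasure_zero_of_coordinates {Ω : Type*} [MeasurableSpace Ω] {μ : Measure Ω}
    [IsFiniteMeasure μ] {m : ℕ} {Y : ℕ → Ω → EuclideanSpace ℝ (Fin m)}
    (h : ∀ k, ∀ ε : ℝ, 0 < ε → Tendsto (fun n => μ.real {ω | ε ≤ |Y n ω k|}) atTop (nhds 0)) :
    TendstoInMeasure μ Y atTop 0 := by
  rw [tendstoInMeasure_iff_measureReal_norm]
  intro ε hε
  -- Dividing by m + 1 instead of m covers m = 0 and leaves the strict inequality mε/(m + 1) < ε.
  have hsum : Tendsto (fun n => ∑ k, μ.real {ω | ε / (m + 1) ≤ |Y n ω k|}) atTop (nhds 0) := by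
    simpa using tendsto_finsetSum Finset.univ fun k _ => h k (ε / (m + 1)) (by positivity)
  refine squeeze_zero (fun n => measureReal_nonneg) (fun n => ?_) hsum
  refine (measureReal_mono ?_ (measure_ne_top _ _)).trans (measureReal_iUnion_fintype_le _)
  intro ω hω
  have hω' : ε ≤ ‖Y n ω‖ := by simpa using hω
  by_contra hcon
  have hlt : ∀ k, |Y n ω k| < ε / (m + 1) := by
    intro k
    by_contra hk
    exact hcon (Set.mem_iUnion.2 ⟨k, not_lt.1 hk⟩)
  have hnorm : ‖Y n ω‖ ≤ ∑ k, |Y n ω k| := by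
    rw [EuclideanSpace.norm_eq]
    refine Real.sqrt_le_iff.2 ⟨Finset.sum_nonneg fun k _ => abs_nonneg _, ?_⟩
    simpa using Finset.sum_sq_le_sq_sum_of_nonneg fun k _ => abs_nonneg (Y n ω k)
  have hle : ∑ k, |Y n ω k| ≤ m * (ε / (m + 1)) := by
    refine (Finset.sum_le_sum fun k _ => (hlt k).le).trans_eq ?_
    simp
  have : m * (ε / (m + 1)) < ε := by
    rw [mul_div_assoc', div_lt_iff₀ (by positivity)]
    nlinarith
  linarith

/-- The limit covariance matrix for disjoint conditioning sets. -/
theorem limitCov_eq_diagonal {P : Measure (Fin (q + 2) → ℝ)} [IsProbabilityMeasure P] {m : ℕ}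
    {A : Fin m → Set (Fin q → ℝ)} (hA : ∀ k, MeasurableSet (A k)) (hp : ∀ k, 0 < prob P (A k))
    (htau : ∀ k, tau P (A k) = 4 * concD P (A k) / prob P (A k) ^ 2 - 1)
    (hdisj : Pairwise fun k l => Disjoint (A k) (A l)) :
    limitCov P A = Matrix.diagonal fun k => 16 * (4 * coefI P (A k) (A k) / prob P (A k) ^ 2
      - (1 + tau P (A k)) ^ 2 / (4 * prob P (A k))) := by
  ext k l
  by_cases hkl : k = l
  · subst hkl
    -- With this value the three terms containing D add up to -D²/p⁵, while (1 + τ)² = 16D²/p⁴.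
    have hJ : coefJ P (A k) (A k) = concD P (A k) / prob P (A k) := by
      rw [coefJ_eq, Set.inter_self, integral_ind_mul_condMean (hA k) (hp k)]
    have := (hp k).ne'
    rw [Matrix.diagonal_apply_eq, limitCov, Matrix.of_apply, hJ, Set.inter_self, htau]
    field_simp
    ring
  · have hkl' := (hdisj hkl).inter_eq
    have hlk' := (hdisj (Ne.symm hkl)).inter_eq
    rw [Matrix.diagonal_apply_ne _ hkl, limitCov, Matrix.of_apply, coefI_eq, coefJ_eq, coefJ_eq,
      hkl', hlk']
    simp [ind, prob]

end Limit

end CondKendall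

theorem mainTheorem2 {Ω : Type*} [MeasurableSpace Ω] (μ : Measure Ω) [IsProbabilityMeasure μ]
    {q m : ℕ} (P : Measure (Fin (q + 2) → ℝ)) (X : ℕ → Ω → Fin (q + 2) → ℝ)
    (hindep : iIndepFun X μ) (hlaw : ∀ i, HasLaw (X i) P μ)
    (A : Fin m → Set (Fin q → ℝ)) (hA : ∀ k, MeasurableSet (A k))
    (hpos : ∀ k, 0 < P {x | CondKendall.coordJ x ∈ A k})
    (hcont₁ : ∀ k, Continuous (cdf ((CondKendall.condLaw P (A k)).map fun x => x 0)))
    (hcont₂ : ∀ k, Continuous (cdf ((CondKendall.condLaw P (A k)).map fun x => x 1))) :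
    (CondKendall.limitCov P A).PosSemidef ∧
    (∀ T ∈ ({CondKendall.tauHat, CondKendall.tauHat1, CondKendall.tauHat2, CondKendall.tauHat3} :
        Set (Set (Fin q → ℝ) → ℕ → (ℕ → Fin (q + 2) → ℝ) → ℝ)),
      TendstoInDistribution
        (fun (n : ℕ) ω =>
          CondKendall.scaledVector T A (fun k => CondKendall.tau P (A k)) n (fun i => X i ω))
        atTop (id : EuclideanSpace ℝ (Fin m) → EuclideanSpace ℝ (Fin m)) (fun _ => μ)
        (multivariateGaussian 0 (CondKendall.limitCov P A))) ∧
    (Pairwise (fun k l => Disjoint (A k) (A l)) →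
      CondKendall.limitCov P A = Matrix.diagonal fun k =>
        16 * (4 * CondKendall.coefI P (A k) (A k) / CondKendall.prob P (A k) ^ 2
          - (1 + CondKendall.tau P (A k)) ^ 2 / (4 * CondKendall.prob P (A k)))) := by
  have hP : IsProbabilityMeasure P := (hlaw 0).isProbabilityMeasure_iff.1 inferInstance
  have hX : ∀ i, AEMeasurable (X i) μ := fun i => (hlaw i).aemeasurable
  have hp : ∀ k, 0 < CondKendall.prob P (A k) := fun k => CondKendall.prob_pos (hpos k)
  have hφ : ∀ k, MemLp (CondKendall.influence P (A k)) 2 P := fun k =>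
    CondKendall.memLp_influence (hA k)
  refine ⟨?_, fun T hT => ?_, CondKendall.limitCov_eq_diagonal hA hp fun k =>
    CondKendall.tau_eq (hA k) (hpos k) (hcont₁ k) (hcont₂ k)⟩
  · rw [CondKendall.limitCov_eq A hA]
    exact CondKendall.posSemidef_integral_mul P _ hφ
  · have hclt := CondKendall.tendstoInDistribution_inv_sqrt_mul_sum_vector hindep hlaw
      (fun k => CondKendall.influence P (A k)) (fun k => CondKendall.measurable_influence (hA k)) hφ
      (fun k => CondKendall.integral_influence (hA k) (hp k))
    rw [← CondKendall.limitCov_eq A hA] at hclt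
    -- Slutsky's lemma: the normalized sum of influence functions has the Gaussian limit, and the
    -- estimators differ from it by a term vanishing in probability.
    refine tendstoInDistribution_of_tendstoInMeasure_sub _ _ hclt ?_ fun n => ?_
    · refine CondKendall.tendstoInMeasure_zero_of_coordinates fun k ε hε => ?_
      exact CondKendall.tendsto_measure_expansion hT hindep hlaw (hA k) (hpos k) (hcont₁ k)
        (hcont₂ k) hε
    · refine (WithLp.measurable_toLp 2 _).comp_aemeasurable (aemeasurable_pi_lambda _ fun k => ?_)
      exact (((CondKendall.measurable_estimator hT (hA k) n).comp_aemeasurable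
        (aemeasurable_pi_lambda _ hX)).sub_const _).const_mul _
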